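/- **Setting.** Let $v_2:(0,\infty)\to[-1,\infty)$ be smooth, with $v_2(1)=-1$, $v_2(r)>-1$ for $r\ne1$, $v_2''(1)>0$ and $v_2(r)=0$ for $r\ge 1.1$. Let $v_3:[0,2\pi]\to[0,\infty)$ be smooth with $v_3(\alpha)=v_3(2\pi-\alpha)$, vanishing exactly at $2\pi/3$ and $4\pi/3$, and $v_3''(2\pi/3)>0$. An $L$-periodic configuration in $\mathbb R^3$ (period in direction $e_1$) is described by its atoms $x_1,\dots,x_n$ with $x_i\cdot e_1\in[0,L)$. Put $|x|_L=\min_{t\in\{-1,0,1\}}|x+tLe_1|$; call $(i,j)$, $i\ne j$, bonded if $|x_i-x_j|_L<1.1$. The energy is $$E=\tfrac12\sum_{(i,j)\text{ bonded}}v_2(|x_i-x_j|_L)+\tfrac12\sum_{i\neq k;\ (i,j),(j,k)\text{ bonded}}v_3(\alpha_{ijk}),$$ where $\alpha_{ijk}\in[0,\pi]$ is the angle at $x_j$ between its bonds (modulo $Le_1$) to $x_i$ and $x_k$. For $\ell\in\mathbb N$ ($\ell>3$), $\mu\in(2.6,3.1)$ and $\lambda_1,\lambda_2\in(0.9,1.1)$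 determine $\sigma>0$, $\rho>0$ by $2\sigma+2\lambda_1=\mu$ and $\sigma^2+4\rho^2\sin^2\frac{\pi}{2\ell}=\lambda_2^2$, and let $\mathcal F_{\lambda_1,\lambda_2,\mu}$ be the zigzag nanotube consisting of the points $$\Big(k(\lambda_1+\sigma)+j(2\sigma+2\lambda_1)+l(2\sigma+\lambda_1),\ \rho\cos\tfrac{\pi(2i+k)}{\ell},\ \rho\sin\tfrac{\pi(2i+k)}{\ell}\Big),\quad 1\le i\le\ell,\ j\in\mathbb Z,\ k,l\in\{0,1\}.$$ Its angle $\alpha\in(\pi/2,\pi)$ is given by $\sin\alpha=\sqrt{1-(\sigma/\lambda_2)^2}$, and its radius is $\rho$. Its energy is computed with period $L=m\mu$, $m\ge1$, i.e. on a cell of $n=4m\ell$ atoms. Let $$E_{\min}(\mu)=\min\{E(\mathcal F_{\lambda_1,\lambda_2,\mu}):\lambda_1,\lambda_2\in(0.9,1.1)\}.$$ Let $\gamma_\ell=\pi(1-1/\ell)$ and $\beta(\alpha,\gamma)=2\arcsin(\sin\alpha\sin\frac\gamma2)$. The Rolled-up angle is $\alpha^{\rm ru}=2\pi/3$; the Polyhedral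 angle $\alpha^{\rm ch}_\ell$ is the unique solution of $\beta(\alpha,\gamma_\ell)=\alpha$ in $(\arccos(-0.4),\arccos(-0.6))$. Let $\alpha^{\rm us}_\ell$ be the unique minimizer of $\alpha\mapsto E(\mathcal F_{1,1,2(1-\cos\alpha)})$ among the $\alpha\in(\pi/2,\pi)$ with $2(1-\cos\alpha)\in(2.6,3.1)$, and let $\mu^{\rm us}_\ell=2-2\cos\alpha^{\rm us}_\ell$. **Statement.** There are $\ell_0\in\mathbb N$ and $c>0$, depending only on $v_2,v_3$, such that for every $\ell\ge\ell_0$ the angles $\alpha^{\rm ch}_\ell$ and $\alpha^{\rm us}_\ell$ are well defined, $\alpha^{\rm us}_\ell\in(\alpha^{\rm ch}_\ell,\alpha^{\rm ru})$, and there is an open interval $M^\ell\subset(2.6,3.1)$, depending only on $v_2,v_3,\ell$, with $\mu^{\rm us}_\ell\in M^\ell$, such that for all $\mu\in M^\ell$ the minimum $E_{\min}(\mu)$ is attained at exactly one pair $(\lambda_1^\mu,\lambda_2^\mu)$, which does not depend on $m$, and the following hold (for every $m\ge1$, $n=4m\ell$). 1. $\mu\mapsto E(\mathcal F_{\lambda_1^\mu,\lambda_2^\mu,\mu})=E_{\min}(\mu)$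 is smooth and strictly convex on $M^\ell$ and attains its minimum over $M^\ell$ at $\mu^{\rm us}_\ell$; moreover $\frac{d^2}{d\mu^2}E_{\min}(\mu^{\rm us}_\ell)\ge cn$. 2. $\lambda_1^\mu$ and $\lambda_2^\mu$ are continuous and strictly increasing in $\mu\in M^\ell$; $\lambda_1^\mu,\lambda_2^\mu>1$ for $\mu>\mu^{\rm us}_\ell$, and $\lambda_1^\mu,\lambda_2^\mu<1$ for $\mu<\mu^{\rm us}_\ell$. 3. The angle $\alpha^\mu$ of $\mathcal F_{\lambda_1^\mu,\lambda_2^\mu,\mu}$ satisfies $\alpha^\mu\in(\alpha^{\rm ch}_\ell,\alpha^{\rm ru})$ for all $\mu\in M^\ell$. 4. The radius $\rho^\mu$ of $\mathcal F_{\lambda_1^\mu,\lambda_2^\mu,\mu}$ is continuous and strictly increasing on $M^\ell$ if $v_2''(1)<6v_3''(2\pi/3)$, and continuous and strictly decreasing on $M^\ell$ if $v_2''(1)>6v_3''(2\pi/3)$. -/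

import Mathlib

open Real Set
open scoped ContDiff

noncomputable section

namespace Nanotube

/-! ## Configurations and configurational energy -/

/-- Atomic sites are points of Euclidean three-space. -/
abbrev Space : Type := EuclideanSpace ℝ (Fin 3)

/-- The direction `e₁ = (1,0,0)` of the axis of the tube. -/
def e₁ : Space := !₂[1, 0, 0]

/-- A two-body potential: smooth on `(0,∞)` with values in `[-1,∞)`, the minimum value `-1` being
attained only at `1`, nondegenerate there, and vanishing on `[1.1,∞)`. Values at nonpositive
arguments are irrelevant. -/
structure IsTwoBodyPotential (v₂ : ℝ → ℝ) : Prop where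
  smooth : ContDiffOn ℝ ∞ v₂ (Ioi 0)
  ge_neg_one : ∀ r, 0 < r → -1 ≤ v₂ r
  eq_neg_one_iff : ∀ r, 0 < r → (v₂ r = -1 ↔ r = 1)
  second_deriv_pos : 0 < iteratedDeriv 2 v₂ 1
  short_ranged : ∀ r, 1.1 ≤ r → v₂ r = 0

/-- A three-body potential: smooth on `[0,2π]` with values in `[0,∞)`, symmetric around `π`,
the minimum value `0` being attained only at `2π/3` and `4π/3`, nondegenerate there. -/
structure IsThreeBodyPotential (v₃ : ℝ → ℝ) : Prop where
  smooth : ContDiffOn ℝ ∞ v₃ (Icc 0 (2 * π))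
  nonneg : ∀ α ∈ Icc 0 (2 * π), 0 ≤ v₃ α
  symm : ∀ α ∈ Icc 0 (2 * π), v₃ α = v₃ (2 * π - α)
  eq_zero_iff : ∀ α ∈ Icc 0 (2 * π), (v₃ α = 0 ↔ α = 2 * π / 3 ∨ α = 4 * π / 3)
  second_deriv_pos : 0 < iteratedDeriv 2 v₃ (2 * π / 3)

/-- The distance modulo `L`, `min_{t ∈ {-1,0,1}} |x - y + L t e₁|`. -/
def perDist (L : ℝ) (x y : Space) : ℝ :=
  min ‖x - y‖ (min ‖x - y + L • e₁‖ ‖x - y - L • e₁‖)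

/-- The vector from `y` to the nearest among the periodic images `x + L t e₁`, `t ∈ {-1,0,1}`,
of `x`; its length is `perDist L x y`. (For `L > 0`, at most one of the first two conditions
can hold.) -/
def perVec (L : ℝ) (x y : Space) : Space :=
  open Classical in
  if ‖x - y + L • e₁‖ < ‖x - y‖ then x - y + L • e₁
  else if ‖x - y - L • e₁‖ < ‖x - y‖ then x - y - L • e₁
  else x - y

/-- Ordered pairs of distinct bonded atoms of a cell `C` with period `L`. -/
def bonds (C : Set Space) (L : ℝ) : Set (Space × Space) :=
  {p | p.1 ∈ C ∧ p.2 ∈ C ∧ p.1 ≠ p.2 ∧ perDist L p.1 p.2 < 1.1}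

/-- Ordered triples `(x, y, z)` with `x ≠ z`, both bonded to the middle atom `y`. -/
def triples (C : Set Space) (L : ℝ) : Set (Space × Space × Space) :=
  {t | t.1 ≠ t.2.2 ∧ (t.1, t.2.1) ∈ bonds C L ∧ (t.2.1, t.2.2) ∈ bonds C L}

/-- The bond angle at `y` formed by the bonds from `y` to `x` and from `y` to `z`,
with bonds understood modulo the period. -/
def bondAngle (L : ℝ) (x y z : Space) : ℝ :=
  InnerProductGeometry.angle (perVec L x y) (perVec L z y)

/-- The configurational energy of the `L`-periodic configuration with (finite) cell `C`. -/
def configEnergy (v₂ v₃ : ℝ → ℝ) (C : Set Space) (L : ℝ) : ℝ :=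
  1 / 2 * (∑ᶠ p ∈ bonds C L, v₂ (perDist L p.1 p.2)) +
  1 / 2 * (∑ᶠ t ∈ triples C L, v₃ (bondAngle L t.1 t.2.1 t.2.2))

/-- The cell of a configuration `F` relative to the period `L`: the atoms of `F` whose first
coordinate lies in `[0, L)`. -/
def cell (F : Set Space) (L : ℝ) : Set Space :=
  {x ∈ F | x 0 ∈ Ico 0 L}

/-! ## Zigzag nanotubes -/

/-- The zigzag nanotube with parameters `ℓ`, `lam₁`, `σ`, `ρ`. -/
def zigzag (ℓ : ℕ) (lam₁ σ ρ : ℝ) : Set Space :=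
  {x | ∃ (i : ℕ) (j : ℤ) (k l : ℕ), i ∈ Icc 1 ℓ ∧ k ∈ ({0, 1} : Set ℕ) ∧ l ∈ ({0, 1} : Set ℕ) ∧
    x = !₂[k * (lam₁ + σ) + j * (2 * σ + 2 * lam₁) + l * (2 * σ + lam₁),
           ρ * cos (π * (2 * i + k) / ℓ),
           ρ * sin (π * (2 * i + k) / ℓ)]}

/-- The parameter `σ` determined by `2σ + 2λ₁ = μ`. -/
def tubeSigma (μ lam₁ : ℝ) : ℝ := μ / 2 - lam₁

/-- The radius `ρ` determined by `σ² + 4ρ² sin²(π/(2ℓ)) = λ₂²`, `ρ ≥ 0`. -/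
def tubeRadius (ℓ : ℕ) (μ lam₁ lam₂ : ℝ) : ℝ :=
  √(lam₂ ^ 2 - tubeSigma μ lam₁ ^ 2) / (2 * sin (π / (2 * ℓ)))

/-- The bond lengths `lam₁`, `lam₂` (with `σ`, `ρ` determined by them) define a member
`F_{λ₁,λ₂,μ}` of the family `𝓕(μ)` of zigzag nanotubes with minimal period `μ`. -/
structure InFamily (ℓ : ℕ) (μ lam₁ lam₂ : ℝ) : Prop where
  lam₁_mem : lam₁ ∈ Ioo 0 (μ / 2)
  lam₂_mem : lam₂ ∈ Ioo 0 (μ / 2)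
  sigma_mem : tubeSigma μ lam₁ ∈ Ioo 0 (μ / 2)
  radius_mem : tubeRadius ℓ μ lam₁ lam₂ ∈ Ioo 0 (μ / (4 * sin (π / (2 * ℓ))))
  period : 2 * tubeSigma μ lam₁ + 2 * lam₁ = μ
  bond : tubeSigma μ lam₁ ^ 2 + 4 * tubeRadius ℓ μ lam₁ lam₂ ^ 2 * sin (π / (2 * ℓ)) ^ 2
    = lam₂ ^ 2

/-- The zigzag nanotube `F_{λ₁,λ₂,μ}` (as an infinite periodic configuration). -/
def tube (ℓ : ℕ) (μ lam₁ lam₂ : ℝ) : Set Space :=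
  zigzag ℓ lam₁ (tubeSigma μ lam₁) (tubeRadius ℓ μ lam₁ lam₂)

/-- The energy of `F_{λ₁,λ₂,μ}`, computed with the period `L = m μ`,
i.e. on a cell of `n = 4 m ℓ` atoms. -/
def tubeEnergy (v₂ v₃ : ℝ → ℝ) (ℓ m : ℕ) (μ lam₁ lam₂ : ℝ) : ℝ :=
  configEnergy v₂ v₃ (cell (tube ℓ μ lam₁ lam₂) (m * μ)) (m * μ)

/-- The angle `α ∈ (π/2, π)` with `sin α = √(1 - (σ/λ₂)²)`. -/
def tubeAngle (μ lam₁ lam₂ : ℝ) : ℝ :=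
  π - arcsin √(1 - (tubeSigma μ lam₁ / lam₂) ^ 2)

/-- The internal angle `γ_ℓ` of a regular `2ℓ`-gon. -/
def gam (ℓ : ℕ) : ℝ := π * (1 - 1 / ℓ)

/-- The third bond angle as a function of `α` and `γ`. -/
def beta (α γ : ℝ) : ℝ := 2 * arcsin (sin α * sin (γ / 2))

/-! ## The minimization problems -/

/-- The competitors at minimal period `μ`: pairs of bond lengths in `(0.9, 1.1)` that define a
member of `𝓕(μ)`. -/
def admissible (ℓ : ℕ) (μ : ℝ) : Set (ℝ × ℝ) :=
  {p | InFamily ℓ μ p.1 p.2 ∧ p.1 ∈ Ioo 0.9 1.1 ∧ p.2 ∈ Ioo 0.9 1.1}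

/-- The pair `p` of bond lengths solves the minimization problem at minimal period `μ`. -/
def IsOptimal (v₂ v₃ : ℝ → ℝ) (ℓ m : ℕ) (μ : ℝ) (p : ℝ × ℝ) : Prop :=
  p ∈ admissible ℓ μ ∧
    ∀ q ∈ admissible ℓ μ, tubeEnergy v₂ v₃ ℓ m μ p.1 p.2 ≤ tubeEnergy v₂ v₃ ℓ m μ q.1 q.2

/-- The minimal energy at minimal period `μ`. -/
def Emin (v₂ v₃ : ℝ → ℝ) (ℓ m : ℕ) (μ : ℝ) : ℝ :=
  sInf ((fun p : ℝ × ℝ => tubeEnergy v₂ v₃ ℓ m μ p.1 p.2) '' admissible ℓ μ)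

/-- `α` is the Polyhedral angle: the unique solution of `β(α, γ_ℓ) = α` in
`(arccos (-0.4), arccos (-0.6))`. -/
def IsPolyhedralAngle (ℓ : ℕ) (α : ℝ) : Prop :=
  α ∈ Ioo (arccos (-0.4)) (arccos (-0.6)) ∧
    ∀ α' ∈ Ioo (arccos (-0.4)) (arccos (-0.6)), (beta α' (gam ℓ) = α' ↔ α' = α)

/-- The reference interval of angles: those `α ∈ (π/2, π)` for which the minimal period
`μ = 2 (1 - cos α)` lies in `(2.6, 3.1)`. -/
def refAngles : Set ℝ := {α ∈ Ioo (π / 2) π | 2 * (1 - cos α) ∈ Ioo 2.6 3.1}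

/-- The energy of `𝒢_α`, the nanotube with unit bond lengths and minimal period
`μ = 2 (1 - cos α)`. -/
def unitTubeEnergy (v₂ v₃ : ℝ → ℝ) (ℓ m : ℕ) (α : ℝ) : ℝ :=
  tubeEnergy v₂ v₃ ℓ m (2 * (1 - cos α)) 1 1

/-- `α` is the unique angle in the reference interval such that `𝒢_α` minimizes the energy among
all nanotubes with unit bond lengths (and angle in the reference interval), for every choice of
the number `m` of minimal periods per cell. -/
def IsUnstretchedAngle (v₂ v₃ : ℝ → ℝ) (ℓ : ℕ) (α : ℝ) : Prop :=
  α ∈ refAngles ∧ ∀ m : ℕ, 1 ≤ m → ∀ α' ∈ refAngles,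
    (IsMinOn (unitTubeEnergy v₂ v₃ ℓ m) refAngles α' ↔ α' = α)

end Nanotube

end

open Nanotube

/-! Write `κ = cos (π / ℓ)` and `s = σ / λ₂ = -cos α`. Every atom of the tube has exactly three
bonds, of lengths `λ₁, λ₂, λ₂`, two angles of cosine `-s` and one of cosine `s² - κ (1 - s²)`. Hence
the energy is `n` times `v₂(λ₁)/2 + v₂(λ₂) + g(s)` with `s = (μ/2 - λ₁)/λ₂`, where `g = angleEnergy
v₃ κ` (`tubeEnergy_eq`). Neither `m` nor the shape of the cell enters any more, and `ℓ` enters only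
through `κ`, which tends to `1` from below.

The angles: the Polyhedral angle is `s = κ/(1+κ)` and the Rolled-up angle is `s = 1/2`. For `κ` near
`1`, `g'` is negative at the former and positive at the latter, and `g''` is close to `8 v₃''(2π/3)
> 0` near `1/2`. So `g` has a minimizer `s₀` strictly between the two, and it is the only one among
all relevant slopes (`eventually_exists_unstretched`).

The stretching: at `μ₀ = 2(1+s₀)` the pair `(1,1)` minimizes each of the three terms separately,
hence is the only minimizer. By compactness, minimizers for nearby `μ` stay near `(1,1)`
(`eventually_minimizer_iff`), where the critical point equations have a single smooth branch of
solutions (`exists_critical_branch`). The branch depends smoothly on `μ`, so every assertion near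
`μ₀` follows from the sign of a derivative at `μ₀` (`exists_stretched_minimizers`). With `A =
v₂''(1)`, `G = g''(s₀)` and `D = 1 + (2+s₀²) G/A`, both `λ₁'` and `λ₂'` are positive, the energy per
atom has second derivative `G/(4D)`, and the squared radius moves with the sign of `G(1-s₀²) - A`.
As `κ → 1`, `G(1-s₀²)` tends to `6 v₃''(2π/3)`, which is the threshold for the radius. -/

section Calculus

open Filter Topology

namespace Nanotube

/-! ## Smooth functions near a point of the line -/

/-- `f` is smooth in a neighbourhood of `x`. -/
def SmoothNear (f : ℝ → ℝ) (x : ℝ) : Prop := ∀ᶠ y in 𝓝 x, ContDiffAt ℝ ∞ f y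

namespace SmoothNear

variable {f h : ℝ → ℝ} {x : ℝ}

theorem contDiffAt (hf : SmoothNear f x) : ContDiffAt ℝ ∞ f x := hf.self_of_nhds

/-- This is what the neighbourhood in the definition is for: `ContDiffAt ℝ ∞ f x` alone provides a
neighbourhood only for each finite order. -/
theorem eventually (hf : SmoothNear f x) : ∀ᶠ y in 𝓝 x, SmoothNear f y := eventually_eventually_nhds.2 hf

theorem continuousAt (hf : SmoothNear f x) : ContinuousAt f x := hf.contDiffAt.continuousAt

theorem differentiableAt (hf : SmoothNear f x) : DifferentiableAt ℝ f x :=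
  hf.contDiffAt.differentiableAt (by simp)

theorem hasDerivAt (hf : SmoothNear f x) : HasDerivAt f (deriv f x) x :=
  hf.differentiableAt.hasDerivAt

theorem of_contDiffOn {s : Set ℝ} (hs : IsOpen s) (hf : ContDiffOn ℝ ∞ f s) (hx : x ∈ s) :
    SmoothNear f x := by
  filter_upwards [hs.mem_nhds hx] with y hy using hf.contDiffAt (hs.mem_nhds hy)

theorem of_contDiff (hf : ContDiff ℝ ∞ f) : SmoothNear f x :=
  Eventually.of_forall fun _ => hf.contDiffAt

theorem deriv (hf : SmoothNear f x) : SmoothNear (deriv f) x := by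
  obtain ⟨s, hs, hso, hxs⟩ := eventually_nhds_iff.1 hf
  refine of_contDiffOn hso ?_ hxs
  have : ContDiffOn ℝ ∞ f s := fun y hy => (hs y hy).contDiffWithinAt
  exact this.deriv_of_isOpen hso (by simp)

theorem comp (hh : SmoothNear h (f x)) (hf : SmoothNear f x) :
    SmoothNear (fun y => h (f y)) x := by
  filter_upwards [hf.continuousAt.eventually hh, hf] with y h1 h2 using h1.comp y h2

theorem add (hf : SmoothNear f x) (hh : SmoothNear h x) : SmoothNear (fun y => f y + h y) x := by
  filter_upwards [hf, hh] with y h1 h2 using h1.add h2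

theorem mul (hf : SmoothNear f x) (hh : SmoothNear h x) : SmoothNear (fun y => f y * h y) x := by
  filter_upwards [hf, hh] with y h1 h2 using h1.mul h2

theorem sub (hf : SmoothNear f x) (hh : SmoothNear h x) : SmoothNear (fun y => f y - h y) x := by
  filter_upwards [hf, hh] with y h1 h2 using h1.sub h2

theorem div (hf : SmoothNear f x) (hh : SmoothNear h x) (h0 : h x ≠ 0) :
    SmoothNear (fun y => f y / h y) x := by
  filter_upwards [hf, hh, hh.continuousAt.eventually_ne h0] with y h1 h2 h3 using h1.div h2 h3

theorem const (c : ℝ) : SmoothNear (fun _ => c) x := of_contDiff contDiff_const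

theorem id : SmoothNear (fun y => y) x := of_contDiff contDiff_id

theorem congr (hf : SmoothNear f x) (hh : h =ᶠ[𝓝 x] f) : SmoothNear h x := by
  filter_upwards [hf, eventually_eventually_nhds.2 hh] with y h1 h2 using
    h1.congr_of_eventuallyEq h2

theorem deriv_pos (hf : SmoothNear f x) (h0 : 0 < _root_.deriv f x) :
    ∀ᶠ y in 𝓝 x, 0 < _root_.deriv f y :=
  hf.deriv.continuousAt.eventually_const_lt h0

/-- The inverse function theorem on the line. -/
theorem exists_inverse (hf : SmoothNear f x) (h0 : _root_.deriv f x ≠ 0) :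
    ∃ φ : ℝ → ℝ, φ (f x) = x ∧ (∀ᶠ y in 𝓝 x, φ (f y) = y) ∧ (∀ᶠ z in 𝓝 (f x), f (φ z) = z) ∧
      SmoothNear φ (f x) ∧ HasDerivAt φ (_root_.deriv f x)⁻¹ (f x) := by
  have hs : HasStrictDerivAt f (_root_.deriv f x) x := hf.contDiffAt.hasStrictDerivAt (by simp)
  let e := (hs.hasStrictFDerivAt_equiv h0).toOpenPartialHomeomorph f
  have hxe : x ∈ e.source := (hs.hasStrictFDerivAt_equiv h0).mem_toOpenPartialHomeomorph_source
  have hfe : f x ∈ e.target := (hs.hasStrictFDerivAt_equiv h0).image_mem_toOpenPartialHomeomorph_target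
  have hsx : e.symm (f x) = x := e.left_inv hxe
  refine ⟨e.symm, hsx, e.eventually_left_inverse hxe, e.eventually_right_inverse hfe, ?_, ?_⟩
  · have hc : ContinuousAt e.symm (f x) := e.continuousAt_symm hfe
    -- The derivative stays nonzero near `x`, so the inverse is smooth at every point near `f x`,
    -- not only at `f x`.
    have h1 : ∀ᶠ y in 𝓝 x, ContDiffAt ℝ ∞ f y ∧ _root_.deriv f y ≠ 0 := by
      filter_upwards [hf, hf.deriv.continuousAt.eventually_ne h0] with y h1 h2 using ⟨h1, h2⟩
    have h2 : ∀ᶠ z in 𝓝 (f x), ContDiffAt ℝ ∞ f (e.symm z) ∧ _root_.deriv f (e.symm z) ≠ 0 := by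
      refine hc.eventually (p := fun y => ContDiffAt ℝ ∞ f y ∧ _root_.deriv f y ≠ 0) ?_
      rw [hsx]
      exact h1
    filter_upwards [h2, e.open_target.mem_nhds hfe] with z hz hze
    exact e.contDiffAt_symm_deriv hz.2 hze (hz.1.differentiableAt (by simp)).hasDerivAt hz.1
  · refine e.hasDerivAt_symm hfe h0 ?_
    rw [hsx]
    exact hf.hasDerivAt

end SmoothNear

/-- A property that holds near `x` holds on all small symmetric intervals. -/
theorem eventually_forall_Ioo {P : ℝ → Prop} {x : ℝ} (h : ∀ᶠ y in 𝓝 x, P y) :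
    ∀ᶠ r in 𝓝[>] (0 : ℝ), ∀ y ∈ Ioo (x - r) (x + r), P y := by
  obtain ⟨ε, hε, h⟩ := Metric.eventually_nhds_iff.1 h
  filter_upwards [Ioo_mem_nhdsGT hε] with r hr y hy
  apply h
  rw [Real.dist_eq, abs_lt]
  constructor <;> linarith [hy.1, hy.2, hr.1, hr.2]

theorem SmoothNear.eventually_continuousOn {f : ℝ → ℝ} {x : ℝ} (hf : SmoothNear f x) :
    ∀ᶠ r in 𝓝[>] (0 : ℝ), ContinuousOn f (Ioo (x - r) (x + r)) :=
  (eventually_forall_Ioo hf).mono fun _ h y hy => (h y hy).continuousAt.continuousWithinAt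

theorem SmoothNear.eventually_contDiffOn {f : ℝ → ℝ} {x : ℝ} (hf : SmoothNear f x) :
    ∀ᶠ r in 𝓝[>] (0 : ℝ), ContDiffOn ℝ ∞ f (Ioo (x - r) (x + r)) :=
  (eventually_forall_Ioo hf).mono fun _ h y hy => (h y hy).contDiffWithinAt

theorem SmoothNear.eventually_strictMonoOn {f : ℝ → ℝ} {x : ℝ} (hf : SmoothNear f x)
    (h0 : 0 < _root_.deriv f x) :
    ∀ᶠ r in 𝓝[>] (0 : ℝ), StrictMonoOn f (Ioo (x - r) (x + r)) := by
  filter_upwards [hf.eventually_continuousOn, eventually_forall_Ioo (hf.deriv_pos h0)]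
    with r h1 h2
  exact strictMonoOn_of_deriv_pos (convex_Ioo _ _) h1 (by simpa [interior_Ioo] using h2)

theorem SmoothNear.eventually_strictAntiOn {f : ℝ → ℝ} {x : ℝ} (hf : SmoothNear f x)
    (h0 : _root_.deriv f x < 0) :
    ∀ᶠ r in 𝓝[>] (0 : ℝ), StrictAntiOn f (Ioo (x - r) (x + r)) := by
  filter_upwards [hf.eventually_continuousOn,
    eventually_forall_Ioo (hf.deriv.continuousAt.eventually_lt_const h0)] with r h1 h2
  exact strictAntiOn_of_deriv_neg (convex_Ioo _ _) h1 (by simpa [interior_Ioo] using h2)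

end Nanotube

end Calculus

section Branch

open Filter Topology

namespace Nanotube

/-! ## The stretched branch of critical points -/

/-- The smooth branch of solutions of the critical point equations of
`(p₁, p₂) ↦ v p₁ / 2 + v p₂ + g ((μ / 2 - p₁) / p₂)`, which passes through `(1, 1)`. -/
theorem exists_critical_branch {v g : ℝ → ℝ} {s₀ : ℝ} (hv : SmoothNear v 1) (hv1 : deriv v 1 = 0)
    (ha : 0 < deriv (deriv v) 1) (hg : SmoothNear g s₀) (hg1 : deriv g s₀ = 0)
    (hG : 0 < deriv (deriv g) s₀) :
    ∃ lam₁ lam₂ S : ℝ → ℝ, ∃ D : ℝ,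
      D = 1 + (2 + s₀ ^ 2) * (deriv (deriv g) s₀ / deriv (deriv v) 1) ∧
      SmoothNear lam₁ (2 * (1 + s₀)) ∧ SmoothNear lam₂ (2 * (1 + s₀)) ∧
      SmoothNear S (2 * (1 + s₀)) ∧
      lam₁ (2 * (1 + s₀)) = 1 ∧ lam₂ (2 * (1 + s₀)) = 1 ∧ S (2 * (1 + s₀)) = s₀ ∧
      HasDerivAt lam₁ (2 * (deriv (deriv g) s₀ / deriv (deriv v) 1) / (2 * D)) (2 * (1 + s₀)) ∧
      HasDerivAt lam₂ (s₀ * (deriv (deriv g) s₀ / deriv (deriv v) 1) / (2 * D)) (2 * (1 + s₀)) ∧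
      HasDerivAt S (1 / (2 * D)) (2 * (1 + s₀)) ∧
      (∀ᶠ μ in 𝓝 (2 * (1 + s₀)), μ / 2 = lam₁ μ + S μ * lam₂ μ ∧
        deriv v (lam₁ μ) * lam₂ μ = 2 * deriv g (S μ) ∧
        deriv v (lam₂ μ) * lam₂ μ = S μ * deriv g (S μ)) ∧
      (∀ᶠ z : ℝ × (ℝ × ℝ) in 𝓝 (2 * (1 + s₀), ((1 : ℝ), (1 : ℝ))),
        deriv v z.2.1 * z.2.2 = 2 * deriv g ((z.1 / 2 - z.2.1) / z.2.2) →
        deriv v z.2.2 * z.2.2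
          = (z.1 / 2 - z.2.1) / z.2.2 * deriv g ((z.1 / 2 - z.2.1) / z.2.2) →
        z.2 = (lam₁ z.1, lam₂ z.1)) := by
  -- With the slope `s` as parameter, the system becomes triangular and only one-dimensional
  -- inversions are needed. The second equation gives `p₂` by inverting `x ↦ v'(x) x` at `s g'(s)`,
  -- the first then gives `p₁` by inverting `v'` at `2 g'(s)/p₂`, and finally the period `2(p₁ + s
  -- p₂)`, whose derivative at `s₀` is `2D > 0`, is inverted to express `s` through `μ`.
  set a := deriv (deriv v) 1 with ha_def
  set G := deriv (deriv g) s₀ with hG_def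
  set p := deriv g with hp_def
  have hp : SmoothNear p s₀ := hg.deriv
  have hpd : HasDerivAt p G s₀ := hp.hasDerivAt
  have hdv : SmoothNear (deriv v) 1 := hv.deriv
  obtain ⟨φ₁, -, hφ₁l, hφ₁r, hφ₁s, hφ₁d⟩ := hdv.exists_inverse ha.ne'
  rw [hv1] at hφ₁r hφ₁s hφ₁d
  have hφ₁0 : φ₁ 0 = 1 := by rw [← hv1]; exact hφ₁l.self_of_nhds
  have hh2 : SmoothNear (fun x => deriv v x * x) 1 := hdv.mul .id
  have hh2d : deriv (fun x => deriv v x * x) 1 = a := by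
    have := (hdv.hasDerivAt.mul (hasDerivAt_id (1 : ℝ))).deriv
    simpa [hv1, Pi.mul_def] using this
  obtain ⟨φ₂, -, hφ₂l, hφ₂r, hφ₂s, hφ₂d⟩ := hh2.exists_inverse (hh2d ▸ ha.ne')
  rw [hh2d] at hφ₂d
  simp only [hv1, zero_mul] at hφ₂r hφ₂s hφ₂d
  have hφ₂0 : φ₂ 0 = 1 := by simpa [hv1] using hφ₂l.self_of_nhds
  -- the branch as a function of `s`
  let Λ₂ : ℝ → ℝ := fun s => φ₂ (s * p s)
  have hΛ₂s : SmoothNear Λ₂ s₀ := by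
    refine SmoothNear.comp ?_ (SmoothNear.id.mul hp)
    simpa [hg1] using hφ₂s
  have hΛ₂0 : Λ₂ s₀ = 1 := by simp [Λ₂, hg1, hφ₂0]
  have hΛ₂d : HasDerivAt Λ₂ (s₀ * (G / a)) s₀ := by
    have h1 : HasDerivAt (fun s => s * p s) (1 * p s₀ + s₀ * G) s₀ := (hasDerivAt_id s₀).mul hpd
    have h2 : HasDerivAt φ₂ a⁻¹ ((fun s => s * p s) s₀) := by simpa [hg1] using hφ₂d
    refine (h2.comp s₀ h1).congr_deriv ?_
    rw [hg1]; ring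
  let Λ₁ : ℝ → ℝ := fun s => φ₁ (2 * p s / Λ₂ s)
  have hΛ₁s : SmoothNear Λ₁ s₀ := by
    refine SmoothNear.comp ?_ (((SmoothNear.const 2).mul hp).div hΛ₂s (by simp [hΛ₂0]))
    simpa [hg1] using hφ₁s
  have hΛ₁0 : Λ₁ s₀ = 1 := by simp [Λ₁, hg1, hφ₁0]
  have hΛ₁d : HasDerivAt Λ₁ (2 * (G / a)) s₀ := by
    have h1 : HasDerivAt (fun s => 2 * p s / Λ₂ s) _ s₀ :=
      (hpd.const_mul 2).div hΛ₂d (by simp [hΛ₂0])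
    have h2 : HasDerivAt φ₁ a⁻¹ ((fun s => 2 * p s / Λ₂ s) s₀) := by simpa [hg1] using hφ₁d
    refine (h2.comp s₀ h1).congr_deriv ?_
    rw [hg1, hΛ₂0]; ring
  let M : ℝ → ℝ := fun s => 2 * (Λ₁ s + s * Λ₂ s)
  have hMs : SmoothNear M s₀ := (SmoothNear.const 2).mul (hΛ₁s.add (SmoothNear.id.mul hΛ₂s))
  have hM0 : M s₀ = 2 * (1 + s₀) := by simp [M, hΛ₁0, hΛ₂0]
  obtain ⟨D, hD⟩ : ∃ D, D = 1 + (2 + s₀ ^ 2) * (G / a) := ⟨_, rfl⟩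
  have hDpos : 0 < D := by rw [hD]; positivity
  have hMd : HasDerivAt M (2 * D) s₀ := by
    have h1 : HasDerivAt M (2 * (2 * (G / a) + (1 * Λ₂ s₀ + s₀ * (s₀ * (G / a))))) s₀ :=
      (hΛ₁d.add ((hasDerivAt_id s₀).mul hΛ₂d)).const_mul 2
    convert h1 using 1
    rw [hΛ₂0, hD]; ring
  obtain ⟨S, -, hSl, hSr, hSs, hSd⟩ := hMs.exists_inverse (by rw [hMd.deriv]; positivity)
  rw [hMd.deriv] at hSd
  have hS0 : S (M s₀) = s₀ := hSl.self_of_nhds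
  rw [hM0] at hSr hSs hSd hS0
  have hS0' : S (2 * (1 + s₀)) = s₀ := hS0
  have hSc : Tendsto S (𝓝 (2 * (1 + s₀))) (𝓝 s₀) := by
    have := hSs.continuousAt.tendsto
    rwa [hS0] at this
  -- equations along the branch, in terms of `s`
  have hev2 : ∀ᶠ s in 𝓝 s₀, deriv v (Λ₂ s) * Λ₂ s = s * p s := by
    have hc : Tendsto (fun s => s * p s) (𝓝 s₀) (𝓝 0) := by
      have := (SmoothNear.id.mul hp).continuousAt.tendsto
      simpa [hg1] using this
    exact hc.eventually hφ₂r
  have hev1 : ∀ᶠ s in 𝓝 s₀, deriv v (Λ₁ s) = 2 * p s / Λ₂ s := by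
    have hc : Tendsto (fun s => 2 * p s / Λ₂ s) (𝓝 s₀) (𝓝 0) := by
      have := (((SmoothNear.const 2).mul hp).div hΛ₂s (by simp [hΛ₂0])).continuousAt.tendsto
      simpa [hg1] using this
    exact hc.eventually hφ₁r
  have hne : ∀ᶠ s in 𝓝 s₀, Λ₂ s ≠ 0 := hΛ₂s.continuousAt.eventually_ne (by simp [hΛ₂0])
  refine ⟨fun μ => Λ₁ (S μ), fun μ => Λ₂ (S μ), S, D, hD, ?_, ?_, hSs, ?_, ?_, hS0, ?_, ?_, ?_,
    ?_, ?_⟩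
  · exact SmoothNear.comp (by rwa [hS0]) hSs
  · exact SmoothNear.comp (by rwa [hS0]) hSs
  · simp [hS0, hΛ₁0]
  · simp [hS0, hΛ₂0]
  · have hΛ₁d : HasDerivAt Λ₁ (2 * (G / a)) (S (2 * (1 + s₀))) := by rwa [hS0']
    refine (hΛ₁d.comp _ hSd).congr_deriv ?_
    field_simp
  · have hΛ₂d : HasDerivAt Λ₂ (s₀ * (G / a)) (S (2 * (1 + s₀))) := by rwa [hS0']
    refine (hΛ₂d.comp _ hSd).congr_deriv ?_
    field_simp
  · convert hSd using 1
    ring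
  · filter_upwards [hSr, hSc.eventually hev1, hSc.eventually hev2, hSc.eventually hne]
      with μ h1 h2 h3 h4
    refine ⟨?_, ?_, h3⟩
    · have : 2 * (Λ₁ (S μ) + S μ * Λ₂ (S μ)) = μ := h1
      linarith
    · rw [h2]; field_simp
  -- Uniqueness: the left inverses recover `p₂`, `p₁` and `s` of a critical pair near `(1,1)` in the
  -- same order.
  · have hz1 : Tendsto (fun z : ℝ × (ℝ × ℝ) => z.2.1) (𝓝 (2 * (1 + s₀), ((1 : ℝ), (1 : ℝ))))
        (𝓝 1) := (continuous_fst.comp continuous_snd).tendsto' _ _ rfl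
    have hz2 : Tendsto (fun z : ℝ × (ℝ × ℝ) => z.2.2) (𝓝 (2 * (1 + s₀), ((1 : ℝ), (1 : ℝ))))
        (𝓝 1) := (continuous_snd.comp continuous_snd).tendsto' _ _ rfl
    have hz0 : Tendsto (fun z : ℝ × (ℝ × ℝ) => z.1) (𝓝 (2 * (1 + s₀), ((1 : ℝ), (1 : ℝ))))
        (𝓝 (2 * (1 + s₀))) := continuous_fst.tendsto' _ _ rfl
    have hzs : Tendsto (fun z : ℝ × (ℝ × ℝ) => (z.1 / 2 - z.2.1) / z.2.2)
        (𝓝 (2 * (1 + s₀), ((1 : ℝ), (1 : ℝ)))) (𝓝 s₀) := by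
      have := ((hz0.div_const 2).sub hz1).div hz2 one_ne_zero
      rwa [show (2 * (1 + s₀) / 2 - 1) / 1 = s₀ by ring] at this
    filter_upwards [hz1.eventually hφ₁l, hz2.eventually hφ₂l, hzs.eventually hSl,
      hz2.eventually_ne one_ne_zero] with z h1 h2 h3 h4 c1 c2
    set s := (z.1 / 2 - z.2.1) / z.2.2 with hs
    have e2 : Λ₂ s = z.2.2 := by
      simp only [Λ₂]
      rw [← c2]; exact h2
    have e1 : Λ₁ s = z.2.1 := by
      simp only [Λ₁]
      rw [e2, ← c1, mul_div_assoc, div_self h4, mul_one]; exact h1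
    have e3 : M s = z.1 := by
      have : s * z.2.2 = z.1 / 2 - z.2.1 := div_mul_cancel₀ _ h4
      simp only [M]
      rw [e1, e2, this]
      ring
    rw [e3] at h3
    rw [h3, e1, e2]

end Nanotube

end Branch

section Stretching

open Filter Topology

namespace Nanotube

/-! ## Minimization of the energy per atom at fixed period -/

/-- The energy per atom of a tube with bond lengths `p` and minimal period `μ`, if the angles
contribute `g s`, where `-s` is the cosine of the angle of the tube. -/
noncomputable def energyDensity (v g : ℝ → ℝ) (μ : ℝ) (p : ℝ × ℝ) : ℝ :=
  1 / 2 * v p.1 + v p.2 + g ((μ / 2 - p.1) / p.2)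

/-- The open square of bond lengths. -/
def bondBox : Set (ℝ × ℝ) := Ioo 0.9 1.1 ×ˢ Ioo 0.9 1.1

/-- The extreme slopes are `(1.3 - 1.1)/1.1 > 0.18` and `(1.55 - 0.9)/0.9 < 0.73`. They stay away
from `0` and `1`, so `g` is smooth at all of them, also for pairs on the boundary of the box. -/
theorem slope_mem_Icc {μ : ℝ} {p : ℝ × ℝ} (hμ : μ ∈ Ioo (2.6 : ℝ) 3.1)
    (hp : p ∈ Icc (0.9 : ℝ) 1.1 ×ˢ Icc (0.9 : ℝ) 1.1) :
    (μ / 2 - p.1) / p.2 ∈ Icc (0.18 : ℝ) 0.73 := by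
  obtain ⟨⟨h1, h2⟩, h3, h4⟩ := hp
  obtain ⟨h5, h6⟩ := hμ
  have h0 : 0 < p.2 := by linarith
  constructor
  · rw [le_div_iff₀ h0]; linarith
  · rw [div_le_iff₀ h0]; linarith

theorem bondBox_subset : bondBox ⊆ Icc (0.9 : ℝ) 1.1 ×ˢ Icc (0.9 : ℝ) 1.1 :=
  prod_mono Ioo_subset_Icc_self Ioo_subset_Icc_self

theorem isOpen_bondBox : IsOpen bondBox := isOpen_Ioo.prod isOpen_Ioo

theorem one_mem_bondBox : ((1 : ℝ), (1 : ℝ)) ∈ bondBox := by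
  constructor <;> constructor <;> norm_num

theorem IsTwoBodyPotential.smoothNear {v : ℝ → ℝ} (hv : IsTwoBodyPotential v) {x : ℝ}
    (hx : 0 < x) : SmoothNear v x :=
  .of_contDiffOn isOpen_Ioi hv.smooth hx

theorem IsTwoBodyPotential.one_eq {v : ℝ → ℝ} (hv : IsTwoBodyPotential v) : v 1 = -1 :=
  (hv.eq_neg_one_iff 1 one_pos).2 rfl

theorem IsTwoBodyPotential.deriv_one {v : ℝ → ℝ} (hv : IsTwoBodyPotential v) : deriv v 1 = 0 := by
  refine IsLocalMin.deriv_eq_zero ?_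
  filter_upwards [lt_mem_nhds one_pos] with x hx
  rw [hv.one_eq]
  exact hv.ge_neg_one x hx

theorem iteratedDeriv_two_eq (f : ℝ → ℝ) (x : ℝ) : iteratedDeriv 2 f x = deriv (deriv f) x := by
  rw [iteratedDeriv_succ, iteratedDeriv_one]

theorem IsTwoBodyPotential.deriv_deriv_pos {v : ℝ → ℝ} (hv : IsTwoBodyPotential v) :
    0 < deriv (deriv v) 1 := by
  rw [← iteratedDeriv_two_eq]; exact hv.second_deriv_pos

/-- Joint continuity in the period and the bond lengths, on the closed box, is what the compactness
argument for nearby periods needs. -/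
theorem continuousAt_energyDensity {v g : ℝ → ℝ} (hv : IsTwoBodyPotential v)
    (hg : ContDiffOn ℝ ∞ g (Ioo 0 1)) {μ : ℝ} {p : ℝ × ℝ} (hμ : μ ∈ Ioo (2.6 : ℝ) 3.1)
    (hp : p ∈ Icc (0.9 : ℝ) 1.1 ×ˢ Icc (0.9 : ℝ) 1.1) :
    ContinuousAt (fun z : ℝ × (ℝ × ℝ) => energyDensity v g z.1 z.2) (μ, p) := by
  have hs := slope_mem_Icc hμ hp
  have hs' : SmoothNear g ((μ / 2 - p.1) / p.2) :=
    .of_contDiffOn isOpen_Ioo hg ⟨by linarith [hs.1], by linarith [hs.2]⟩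
  have h1 : 0 < p.1 := by linarith [hp.1.1]
  have h2 : 0 < p.2 := by linarith [hp.2.1]
  have c1 : ContinuousAt (fun z : ℝ × (ℝ × ℝ) => z.2.1) (μ, p) := by fun_prop
  have c2 : ContinuousAt (fun z : ℝ × (ℝ × ℝ) => z.2.2) (μ, p) := by fun_prop
  have c3 : ContinuousAt (fun z : ℝ × (ℝ × ℝ) => (z.1 / 2 - z.2.1) / z.2.2) (μ, p) := by
    refine ContinuousAt.div ?_ c2 h2.ne'
    fun_prop
  have d1 : ContinuousAt (fun z : ℝ × (ℝ × ℝ) => v z.2.1) (μ, p) :=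
    ContinuousAt.comp (f := fun z : ℝ × (ℝ × ℝ) => z.2.1) (hv.smoothNear h1).continuousAt c1
  have d2 : ContinuousAt (fun z : ℝ × (ℝ × ℝ) => v z.2.2) (μ, p) :=
    ContinuousAt.comp (f := fun z : ℝ × (ℝ × ℝ) => z.2.2) (hv.smoothNear h2).continuousAt c2
  have d3 : ContinuousAt (fun z : ℝ × (ℝ × ℝ) => g ((z.1 / 2 - z.2.1) / z.2.2)) (μ, p) :=
    ContinuousAt.comp (f := fun z : ℝ × (ℝ × ℝ) => (z.1 / 2 - z.2.1) / z.2.2)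
      hs'.continuousAt c3
  exact ((d1.const_mul _).add d2).add d3

/-- The critical point equations at a minimizing pair of bond lengths. -/
theorem critical_of_minimizer {v g : ℝ → ℝ} (hv : IsTwoBodyPotential v)
    (hg : ContDiffOn ℝ ∞ g (Ioo 0 1)) {μ : ℝ} {p : ℝ × ℝ} (hμ : μ ∈ Ioo (2.6 : ℝ) 3.1)
    (hp : p ∈ bondBox) (hmin : ∀ q ∈ bondBox, energyDensity v g μ p ≤ energyDensity v g μ q) :
    deriv v p.1 * p.2 = 2 * deriv g ((μ / 2 - p.1) / p.2) ∧
    deriv v p.2 * p.2 = (μ / 2 - p.1) / p.2 * deriv g ((μ / 2 - p.1) / p.2) := by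
  have hp' := bondBox_subset hp
  have hs := slope_mem_Icc hμ hp'
  have hgs : HasDerivAt g (deriv g ((μ / 2 - p.1) / p.2)) ((μ / 2 - p.1) / p.2) :=
    (SmoothNear.of_contDiffOn isOpen_Ioo hg
      ⟨by linarith [hs.1], by linarith [hs.2]⟩).hasDerivAt
  have h1 : 0 < p.1 := by linarith [hp'.1.1]
  have h2 : 0 < p.2 := by linarith [hp'.2.1]
  constructor
  · have hd : HasDerivAt (fun x => energyDensity v g μ (x, p.2))
        (1 / 2 * deriv v p.1 + deriv g ((μ / 2 - p.1) / p.2) * (-1 / p.2)) p.1 := by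
      have e1 : HasDerivAt (fun x : ℝ => (μ / 2 - x) / p.2) (-1 / p.2) p.1 :=
        ((hasDerivAt_id p.1).const_sub (μ / 2)).div_const p.2
      have e2 := hgs.comp p.1 e1
      exact (((hv.smoothNear h1).hasDerivAt.const_mul (1 / 2)).add_const (v p.2)).add e2
    have hm : IsLocalMin (fun x => energyDensity v g μ (x, p.2)) p.1 := by
      filter_upwards [Ioo_mem_nhds hp.1.1 hp.1.2] with x hx
      exact hmin (x, p.2) ⟨hx, hp.2⟩
    have := hm.hasDerivAt_eq_zero hd
    generalize deriv g ((μ / 2 - p.1) / p.2) = d at this ⊢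
    field_simp at this
    linarith
  · have hd : HasDerivAt (fun y => energyDensity v g μ (p.1, y))
        (deriv v p.2 + deriv g ((μ / 2 - p.1) / p.2) * (-(μ / 2 - p.1) / p.2 ^ 2)) p.2 := by
      have e1 : HasDerivAt (fun y : ℝ => (μ / 2 - p.1) / y) (-(μ / 2 - p.1) / p.2 ^ 2) p.2 := by
        have := (hasDerivAt_const p.2 (μ / 2 - p.1)).div (hasDerivAt_id p.2) h2.ne'
        refine this.congr_deriv ?_
        simp
      have e2 := hgs.comp p.2 e1
      exact ((hv.smoothNear h2).hasDerivAt.const_add (1 / 2 * v p.1)).add e2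
    have hm : IsLocalMin (fun y => energyDensity v g μ (p.1, y)) p.2 := by
      filter_upwards [Ioo_mem_nhds hp.2.1 hp.2.2] with x hx
      exact hmin (p.1, x) ⟨hp.1, hx⟩
    have := hm.hasDerivAt_eq_zero hd
    generalize deriv g ((μ / 2 - p.1) / p.2) = d at this ⊢
    field_simp at this ⊢
    linarith

/-- At the period `2 (1 + s₀)`, the unit bond lengths are strictly optimal. -/
theorem energyDensity_one_lt {v g : ℝ → ℝ} {s₀ : ℝ} (hv : IsTwoBodyPotential v)
    (hs₀ : s₀ ∈ Ioo (0.3 : ℝ) 0.55) (hmin : ∀ s ∈ Icc (0.18 : ℝ) 0.73, s ≠ s₀ → g s₀ < g s)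
    {p : ℝ × ℝ} (hp : p ∈ Icc (0.9 : ℝ) 1.1 ×ˢ Icc (0.9 : ℝ) 1.1) (hp1 : p ≠ (1, 1)) :
    energyDensity v g (2 * (1 + s₀)) (1, 1) < energyDensity v g (2 * (1 + s₀)) p := by
  have hs := slope_mem_Icc (μ := 2 * (1 + s₀)) ⟨by linarith [hs₀.1], by linarith [hs₀.2]⟩ hp
  have h1 : 0 < p.1 := by linarith [hp.1.1]
  have h2 : 0 < p.2 := by linarith [hp.2.1]
  have hg : g s₀ ≤ g ((2 * (1 + s₀) / 2 - p.1) / p.2) := by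
    by_cases h : (2 * (1 + s₀) / 2 - p.1) / p.2 = s₀
    · rw [h]
    · exact (hmin _ hs h).le
  have e1 := hv.ge_neg_one _ h1
  have e2 := hv.ge_neg_one _ h2
  -- Strictness comes from the bonds alone: their energy reaches `-3/2` only if both lengths are
  -- `1`.
  have h3 : -3 / 2 < 1 / 2 * v p.1 + v p.2 := by
    by_contra hcon
    apply hp1
    have f1 := (hv.eq_neg_one_iff _ h1).1 (by linarith)
    have f2 := (hv.eq_neg_one_iff _ h2).1 (by linarith)
    exact Prod.ext f1 f2
  have h4 : (2 * (1 + s₀) / 2 - 1) / 1 = s₀ := by ring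
  simp only [energyDensity, hv.one_eq, h4]
  linarith

end Nanotube

end Stretching

/-! ### Uniqueness and monotonicity of the minimizers near the unstretched period -/

section StretchingMain

open Filter Topology

namespace Nanotube

/-- Near the period `2 (1 + s₀)`, the only minimizer is the one given by a function `lam` such
that critical points near `(1, 1)` are given by `lam`. -/
theorem eventually_minimizer_iff {v g : ℝ → ℝ} {s₀ : ℝ} (hv : IsTwoBodyPotential v)
    (hg : ContDiffOn ℝ ∞ g (Ioo 0 1)) (hs₀ : s₀ ∈ Ioo (0.3 : ℝ) 0.55)
    (hmin : ∀ s ∈ Icc (0.18 : ℝ) 0.73, s ≠ s₀ → g s₀ < g s) {lam : ℝ → ℝ × ℝ}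
    (hlam : ∀ᶠ z : ℝ × (ℝ × ℝ) in 𝓝 (2 * (1 + s₀), ((1 : ℝ), (1 : ℝ))),
        deriv v z.2.1 * z.2.2 = 2 * deriv g ((z.1 / 2 - z.2.1) / z.2.2) →
        deriv v z.2.2 * z.2.2
          = (z.1 / 2 - z.2.1) / z.2.2 * deriv g ((z.1 / 2 - z.2.1) / z.2.2) →
        z.2 = lam z.1) :
    ∀ᶠ μ in 𝓝 (2 * (1 + s₀)), ∀ p : ℝ × ℝ,
      (p ∈ bondBox ∧ ∀ q ∈ bondBox, energyDensity v g μ p ≤ energyDensity v g μ q) ↔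
        p = lam μ := by
  have hμ₀ : 2 * (1 + s₀) ∈ Ioo (2.6 : ℝ) 3.1 := ⟨by linarith [hs₀.1], by linarith [hs₀.2]⟩
  have hK : IsCompact (Icc (0.9 : ℝ) 1.1 ×ˢ Icc (0.9 : ℝ) 1.1) := isCompact_Icc.prod isCompact_Icc
  -- A dichotomy around each point of the closed box: away from `(1,1)` the competitor `(1,1)` is
  -- strictly better, also for nearby periods; close to `(1,1)` critical points lie on the branch.
  have hloc : ∀ y ∈ Icc (0.9 : ℝ) 1.1 ×ˢ Icc (0.9 : ℝ) 1.1,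
      ∀ᶠ z : ℝ × (ℝ × ℝ) in 𝓝 (2 * (1 + s₀), y),
        energyDensity v g z.1 (1, 1) < energyDensity v g z.1 z.2 ∨
        (z.2 ∈ bondBox ∧
          (deriv v z.2.1 * z.2.2 = 2 * deriv g ((z.1 / 2 - z.2.1) / z.2.2) →
          deriv v z.2.2 * z.2.2
            = (z.1 / 2 - z.2.1) / z.2.2 * deriv g ((z.1 / 2 - z.2.1) / z.2.2) →
          z.2 = lam z.1)) := by
    intro y hy
    by_cases hy1 : y = (1, 1)
    · subst hy1
      have hb : ∀ᶠ z : ℝ × (ℝ × ℝ) in 𝓝 (2 * (1 + s₀), ((1 : ℝ), (1 : ℝ))), z.2 ∈ bondBox :=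
        continuous_snd.continuousAt.eventually (isOpen_bondBox.mem_nhds one_mem_bondBox)
      filter_upwards [hlam, hb] with z h1 h2 using Or.inr ⟨h2, h1⟩
    · have c1 := continuousAt_energyDensity hv hg hμ₀ hy
      have c2 : ContinuousAt (fun z : ℝ × (ℝ × ℝ) => energyDensity v g z.1 (1, 1))
          (2 * (1 + s₀), y) :=
        ContinuousAt.comp (f := fun z : ℝ × (ℝ × ℝ) => (z.1, ((1 : ℝ), (1 : ℝ))))
          (g := fun z : ℝ × (ℝ × ℝ) => energyDensity v g z.1 z.2)
          (continuousAt_energyDensity hv hg hμ₀ (bondBox_subset one_mem_bondBox)) (by fun_prop)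
      filter_upwards [c2.eventually_lt c1 (energyDensity_one_lt hv hs₀ hmin hy hy1)] with z hz
        using Or.inl hz
  -- Compactness of the box makes the dichotomy uniform in the period.
  have hev := hK.eventually_forall_of_forall_eventually
    (P := fun μ p => energyDensity v g μ (1, 1) < energyDensity v g μ p ∨
        (p ∈ bondBox ∧
          (deriv v p.1 * p.2 = 2 * deriv g ((μ / 2 - p.1) / p.2) →
          deriv v p.2 * p.2
            = (μ / 2 - p.1) / p.2 * deriv g ((μ / 2 - p.1) / p.2) →
          p = lam μ))) hloc
  filter_upwards [hev, Ioo_mem_nhds hμ₀.1 hμ₀.2] with μ hall hμ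
  have huniq : ∀ p ∈ bondBox,
      (∀ q ∈ bondBox, energyDensity v g μ p ≤ energyDensity v g μ q) → p = lam μ := by
    intro p hp hpm
    rcases hall p (bondBox_subset hp) with h | h
    · exact absurd (hpm _ one_mem_bondBox) (not_le.2 h)
    · obtain ⟨c1, c2⟩ := critical_of_minimizer hv hg hμ hp hpm
      exact h.2 c1 c2
  have hcont : ContinuousOn (fun p => energyDensity v g μ p)
      (Icc (0.9 : ℝ) 1.1 ×ˢ Icc (0.9 : ℝ) 1.1) := fun p hp =>
    (ContinuousAt.comp (f := fun p : ℝ × ℝ => (μ, p))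
      (g := fun z : ℝ × (ℝ × ℝ) => energyDensity v g z.1 z.2)
      (continuousAt_energyDensity hv hg hμ hp) (by fun_prop)).continuousWithinAt
  obtain ⟨p₀, hp₀, hp₀m⟩ := hK.exists_isMinOn ⟨_, bondBox_subset one_mem_bondBox⟩ hcont
  -- A minimizer over the closed box is not on its boundary, since there `(1,1)` is strictly better.
  have hp₀b : p₀ ∈ bondBox := by
    rcases hall p₀ hp₀ with h | h
    · exact absurd (hp₀m (bondBox_subset one_mem_bondBox)) (not_le.2 h)
    · exact h.1
  have hp₀o : ∀ q ∈ bondBox, energyDensity v g μ p₀ ≤ energyDensity v g μ q :=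
    fun q hq => hp₀m (bondBox_subset hq)
  intro p
  constructor
  · exact fun h => huniq p h.1 h.2
  · rintro rfl
    rw [← huniq p₀ hp₀b hp₀o]
    exact ⟨hp₀b, hp₀o⟩

/-- Existence, uniqueness and properties of the optimal pairs of bond lengths for periods near
the unstretched one, for a given contribution `g` of the angles. -/
theorem exists_stretched_minimizers {v g : ℝ → ℝ} {s₀ : ℝ} (hv : IsTwoBodyPotential v)
    (hg : ContDiffOn ℝ ∞ g (Ioo 0 1)) (hs₀ : s₀ ∈ Ioo (0.3 : ℝ) 0.55)
    (hmin : ∀ s ∈ Icc (0.18 : ℝ) 0.73, s ≠ s₀ → g s₀ < g s)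
    (hG : 0 < deriv (deriv g) s₀) {U : Set ℝ} (hU : U ∈ 𝓝 s₀) :
    ∃ (a b : ℝ) (lam₁ lam₂ : ℝ → ℝ), 2 * (1 + s₀) ∈ Ioo a b ∧ Ioo a b ⊆ Ioo 2.6 3.1 ∧
      (∀ μ ∈ Ioo a b, ∀ p : ℝ × ℝ,
        (p ∈ bondBox ∧ ∀ q ∈ bondBox, energyDensity v g μ p ≤ energyDensity v g μ q) ↔
          p = (lam₁ μ, lam₂ μ)) ∧
      ContDiffOn ℝ ∞ (fun μ => energyDensity v g μ (lam₁ μ, lam₂ μ)) (Ioo a b) ∧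
      StrictConvexOn ℝ (Ioo a b) (fun μ => energyDensity v g μ (lam₁ μ, lam₂ μ)) ∧
      IsMinOn (fun μ => energyDensity v g μ (lam₁ μ, lam₂ μ)) (Ioo a b) (2 * (1 + s₀)) ∧
      iteratedDeriv 2 (fun μ => energyDensity v g μ (lam₁ μ, lam₂ μ)) (2 * (1 + s₀)) =
        deriv (deriv g) s₀ /
          (4 * (1 + (2 + s₀ ^ 2) * (deriv (deriv g) s₀ / deriv (deriv v) 1))) ∧
      ContinuousOn lam₁ (Ioo a b) ∧ StrictMonoOn lam₁ (Ioo a b) ∧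
      ContinuousOn lam₂ (Ioo a b) ∧ StrictMonoOn lam₂ (Ioo a b) ∧
      lam₁ (2 * (1 + s₀)) = 1 ∧ lam₂ (2 * (1 + s₀)) = 1 ∧
      (∀ μ ∈ Ioo a b, (μ / 2 - lam₁ μ) / lam₂ μ ∈ U) ∧
      (deriv (deriv v) 1 < deriv (deriv g) s₀ * (1 - s₀ ^ 2) →
        StrictMonoOn (fun μ => lam₂ μ ^ 2 - (μ / 2 - lam₁ μ) ^ 2) (Ioo a b)) ∧
      (deriv (deriv g) s₀ * (1 - s₀ ^ 2) < deriv (deriv v) 1 →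
        StrictAntiOn (fun μ => lam₂ μ ^ 2 - (μ / 2 - lam₁ μ) ^ 2) (Ioo a b)) := by
  have hs₀' : s₀ ∈ Ioo (0 : ℝ) 1 := ⟨by linarith [hs₀.1], by linarith [hs₀.2]⟩
  have hμ₀ : 2 * (1 + s₀) ∈ Ioo (2.6 : ℝ) 3.1 := ⟨by linarith [hs₀.1], by linarith [hs₀.2]⟩
  have hgs : SmoothNear g s₀ := .of_contDiffOn isOpen_Ioo hg hs₀'
  have hg1 : deriv g s₀ = 0 := by
    refine IsLocalMin.deriv_eq_zero ?_
    filter_upwards [Ioo_mem_nhds (show (0.18 : ℝ) < s₀ by linarith [hs₀.1])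
      (show s₀ < (0.73 : ℝ) by linarith [hs₀.2])] with s hs
    by_cases h : s = s₀
    · rw [h]
    · exact (hmin s (Ioo_subset_Icc_self hs) h).le
  have ha := hv.deriv_deriv_pos
  have hv1 := hv.smoothNear one_pos
  obtain ⟨lam₁, lam₂, S, D, hD, s1, s2, sS, v1, v2, vS, d1, d2, dS, hcrit, huniq⟩ :=
    exists_critical_branch hv1 hv.deriv_one ha hgs hg1 hG
  have hmini := eventually_minimizer_iff hv hg hs₀ hmin (lam := fun μ => (lam₁ μ, lam₂ μ)) huniq
  set a := deriv (deriv v) 1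
  set G := deriv (deriv g) s₀
  set μ₀ := 2 * (1 + s₀) with hμ₀def
  have hDpos : 0 < D := by rw [hD]; positivity
  set E : ℝ → ℝ := fun μ => energyDensity v g μ (lam₁ μ, lam₂ μ) with hEdef
  have hne : ∀ᶠ μ in 𝓝 μ₀, lam₂ μ ≠ 0 := s2.continuousAt.eventually_ne (by simp [v2])
  have hS : ∀ᶠ μ in 𝓝 μ₀, (μ / 2 - lam₁ μ) / lam₂ μ = S μ := by
    filter_upwards [hne, hcrit] with μ h1 h2
    rw [h2.1]; field_simp; ring
  have hE : E =ᶠ[𝓝 μ₀] fun μ => 1 / 2 * v (lam₁ μ) + v (lam₂ μ) + g (S μ) := by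
    filter_upwards [hS] with μ h
    simp only [hEdef, energyDensity, h]
  have w1 : SmoothNear (fun μ => v (lam₁ μ)) μ₀ := SmoothNear.comp (by rwa [v1]) s1
  have w2 : SmoothNear (fun μ => v (lam₂ μ)) μ₀ := SmoothNear.comp (by rwa [v2]) s2
  have wS : SmoothNear (fun μ => g (S μ)) μ₀ := SmoothNear.comp (by rwa [vS]) sS
  have hEs : SmoothNear E μ₀ := ((((SmoothNear.const _).mul w1).add w2).add wS).congr hE
  -- Envelope theorem: at critical pairs the variation of the bond lengths does not contribute, and
  -- only the explicit dependence of the slope on `μ` remains. The relation between the derivatives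
  -- of the lengths and of `S` comes from differentiating `λ₁ + S λ₂ = μ/2`.
  have hE' : deriv E =ᶠ[𝓝 μ₀] fun μ => deriv g (S μ) / (2 * lam₂ μ) := by
    have n1 : ∀ᶠ μ in 𝓝 μ₀, SmoothNear v (lam₁ μ) :=
      s1.continuousAt.eventually (p := fun x => SmoothNear v x) (by rw [v1]; exact hv1.eventually)
    have n2 : ∀ᶠ μ in 𝓝 μ₀, SmoothNear v (lam₂ μ) :=
      s2.continuousAt.eventually (p := fun x => SmoothNear v x) (by rw [v2]; exact hv1.eventually)
    have nS : ∀ᶠ μ in 𝓝 μ₀, SmoothNear g (S μ) :=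
      sS.continuousAt.eventually (p := fun x => SmoothNear g x) (by rw [vS]; exact hgs.eventually)
    filter_upwards [hE.eventuallyEq_nhds, s1.eventually, s2.eventually, sS.eventually, n1, n2, nS,
      hcrit.eventually_nhds, hne] with μ e0 e1 e2 e3 m1 m2 m3 hc hl
    rw [e0.deriv_eq]
    have f1 := (m1.hasDerivAt.comp μ e1.hasDerivAt).const_mul (1 / 2)
    have f2 := m2.hasDerivAt.comp μ e2.hasDerivAt
    have f3 := m3.hasDerivAt.comp μ e3.hasDerivAt
    have f : HasDerivAt (fun μ => 1 / 2 * v (lam₁ μ) + v (lam₂ μ) + g (S μ)) _ μ :=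
      (f1.add f2).add f3
    rw [f.deriv]
    have hc0 := hc.self_of_nhds
    have hc1 : (fun μ => lam₁ μ + S μ * lam₂ μ) =ᶠ[𝓝 μ] fun μ => μ / 2 :=
      hc.mono fun _ h => h.1.symm
    have k1 : HasDerivAt (fun μ => lam₁ μ + S μ * lam₂ μ) _ μ :=
      e1.hasDerivAt.add (e3.hasDerivAt.mul e2.hasDerivAt)
    have k2 : HasDerivAt (fun μ : ℝ => μ / 2) (1 / 2) μ := (hasDerivAt_id μ).div_const 2
    have k := (k1.congr_of_eventuallyEq hc1.symm).unique k2
    obtain ⟨-, g1, g2⟩ := hc0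
    rw [eq_div_iff (by positivity)]
    generalize deriv v (lam₁ μ) = A at *
    generalize deriv v (lam₂ μ) = B at *
    generalize deriv g (S μ) = C at *
    generalize deriv lam₁ μ = x at *
    generalize deriv lam₂ μ = y at *
    generalize deriv S μ = z at *
    linear_combination x * g1 + 2 * y * g2 + 2 * C * k
  -- The term with the derivative of `lam₂` carries the factor `g'(s₀) = 0`; what is left is `G
  -- S'(μ₀)/2` with `S'(μ₀) = 1/(2D)`.
  have hE'' : deriv (deriv E) μ₀ = G / (4 * D) := by
    rw [hE'.deriv_eq]
    have hgd : HasDerivAt (deriv g) G (S μ₀) := by rw [vS]; exact hgs.deriv.hasDerivAt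
    have := ((hgd.comp μ₀ dS).div (d2.const_mul 2) (by simp [v2])).deriv
    rw [show (fun μ => deriv g (S μ) / (2 * lam₂ μ))
      = (deriv g ∘ S) / (fun μ => 2 * lam₂ μ) from rfl, this]
    simp only [Function.comp_apply, vS, v2, hg1]
    field_simp
    ring
  -- `R = λ₂² - σ²` is the square of the radius up to the constant factor `4 sin²(π/(2ℓ))`.
  set R : ℝ → ℝ := fun μ => lam₂ μ ^ 2 - (μ / 2 - lam₁ μ) ^ 2 with hR
  have hRs : SmoothNear R μ₀ := by
    have h2 : SmoothNear (fun μ => lam₂ μ * lam₂ μ) μ₀ := s2.mul s2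
    have h1 : SmoothNear (fun μ => μ / 2 - lam₁ μ) μ₀ :=
      (SmoothNear.id.div (.const 2) two_ne_zero).sub s1
    refine (h2.sub (h1.mul h1)).congr (Eventually.of_forall fun μ => ?_)
    simp only [hR]; ring
  have hRd : deriv R μ₀ = s₀ / (D * a) * (G * (1 - s₀ ^ 2) - a) := by
    have h1 : HasDerivAt (fun μ : ℝ => μ / 2 - lam₁ μ) _ μ₀ :=
      ((hasDerivAt_id μ₀).div_const 2).sub d1
    have h2 : HasDerivAt R _ μ₀ := (d2.pow 2).sub (h1.pow 2)
    rw [h2.deriv, v1, v2]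
    have e : μ₀ / 2 - 1 = s₀ := by rw [hμ₀def]; ring
    rw [e]
    have hDx : D = 1 + (2 + s₀ ^ 2) * (G / a) := hD
    have hGx : G = a * (G / a) := by field_simp
    generalize G / a = x at *
    rw [hGx]
    field_simp
    rw [hDx]
    push_cast
    ring
  have hUe : ∀ᶠ μ in 𝓝 μ₀, (μ / 2 - lam₁ μ) / lam₂ μ ∈ U := by
    filter_upwards [hS, sS.continuousAt.eventually (p := fun x => x ∈ U) (by rw [vS]; exact hU)]
      with μ h1 h2
    rwa [h1]
  -- The case distinction precedes the choice of the interval, so that one interval serves both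
  -- implications.
  have hmono : ∀ᶠ r in 𝓝[>] (0 : ℝ), a < G * (1 - s₀ ^ 2) →
      StrictMonoOn R (Ioo (μ₀ - r) (μ₀ + r)) := by
    by_cases h : a < G * (1 - s₀ ^ 2)
    · have : 0 < deriv R μ₀ := by
        rw [hRd]
        exact mul_pos (div_pos hs₀'.1 (by positivity)) (by linarith)
      exact (hRs.eventually_strictMonoOn this).mono fun r hr _ => hr
    · exact Eventually.of_forall fun r hr => absurd hr h
  have hanti : ∀ᶠ r in 𝓝[>] (0 : ℝ), G * (1 - s₀ ^ 2) < a →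
      StrictAntiOn R (Ioo (μ₀ - r) (μ₀ + r)) := by
    by_cases h : G * (1 - s₀ ^ 2) < a
    · have : deriv R μ₀ < 0 := by
        rw [hRd]
        exact mul_neg_of_pos_of_neg (div_pos hs₀'.1 (by positivity)) (by linarith)
      exact (hRs.eventually_strictAntiOn this).mono fun r hr _ => hr
    · exact Eventually.of_forall fun r hr => absurd hr h
  have p1 : 0 < deriv lam₁ μ₀ := by rw [d1.deriv]; positivity
  have p2 : 0 < deriv lam₂ μ₀ := by
    rw [d2.deriv]; have := hs₀'.1; positivity
  have pE : 0 < deriv (deriv E) μ₀ := by rw [hE'']; positivity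
  have hall := (eventually_mem_nhdsWithin (a := (0 : ℝ)) (s := Ioi 0)).and <|
    (eventually_forall_Ioo (Ioo_mem_nhds hμ₀.1 hμ₀.2)).and <|
    (eventually_forall_Ioo hmini).and <| hEs.eventually_contDiffOn.and <|
    (hEs.deriv.eventually_strictMonoOn pE).and <| s1.eventually_continuousOn.and <|
    (s1.eventually_strictMonoOn p1).and <| s2.eventually_continuousOn.and <|
    (s2.eventually_strictMonoOn p2).and <| (eventually_forall_Ioo hUe).and <| hmono.and hanti
  obtain ⟨r, hr0, r1, r2, r3, r4, r5, r6, r7, r8, r9, r10, r11⟩ := hall.exists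
  have hr0 : 0 < r := hr0
  refine ⟨μ₀ - r, μ₀ + r, lam₁, lam₂, ⟨by linarith, by linarith⟩, r1, r2, r3, ?_, ?_, ?_, r5, r6,
    r7, r8, v1, v2, r9, r10, r11⟩
  · exact StrictMonoOn.strictConvexOn_of_deriv (convex_Ioo _ _) r3.continuousOn
      (by rwa [interior_Ioo])
  -- Minimality at `μ₀` needs no convexity: there each of the three terms is at its lower bound.
  · intro μ hμ
    have hb := bondBox_subset ((r2 μ hμ _).2 rfl).1
    have hs := slope_mem_Icc (r1 μ hμ) hb
    have e1 := hv.ge_neg_one (lam₁ μ) (by linarith [hb.1.1])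
    have e2 := hv.ge_neg_one (lam₂ μ) (by linarith [hb.2.1])
    have e3 : g s₀ ≤ g ((μ / 2 - lam₁ μ) / lam₂ μ) := by
      by_cases h : (μ / 2 - lam₁ μ) / lam₂ μ = s₀
      · rw [h]
      · exact (hmin _ hs h).le
    have h4 : (μ₀ / 2 - 1) / 1 = s₀ := by rw [hμ₀def]; ring
    have h5 : E μ₀ = -3 / 2 + g s₀ := by
      simp only [hEdef, energyDensity, v1, v2, hv.one_eq, h4]; ring
    change E μ₀ ≤ E μ
    rw [h5]
    simp only [hEdef, energyDensity]
    linarith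
  · rw [iteratedDeriv_two_eq, hE'', hD]

end Nanotube

end StretchingMain

section AngleEnergy

open Filter Topology

namespace Nanotube

/-! ## The contribution of the angles -/

/-- The three-body energy as a function of the cosine of the angle. -/
noncomputable def cosPotential (v₃ : ℝ → ℝ) (x : ℝ) : ℝ := v₃ (arccos x)

/-- The three-body energy per atom, where `-s` is the cosine of the angle of the tube and
`κ = cos (π / ℓ)`. -/
noncomputable def angleEnergy (v₃ : ℝ → ℝ) (κ s : ℝ) : ℝ :=
  2 * cosPotential v₃ (-s) + cosPotential v₃ (s ^ 2 - κ * (1 - s ^ 2))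

theorem arccos_neg_half : arccos (-(1 / 2)) = 2 * π / 3 := by
  refine arccos_eq_of_eq_cos ?_ ?_ ?_
  · positivity
  · linarith [pi_pos]
  · rw [show 2 * π / 3 = π - π / 3 by ring, cos_pi_sub, cos_pi_div_three]

theorem cosPotential_nonneg {v₃ : ℝ → ℝ} (h : IsThreeBodyPotential v₃) (x : ℝ) : 0 ≤ cosPotential v₃ x :=
  h.nonneg _ ⟨arccos_nonneg x, by linarith [arccos_le_pi x, pi_pos]⟩

theorem cosPotential_neg_half {v₃ : ℝ → ℝ} (h : IsThreeBodyPotential v₃) : cosPotential v₃ (-(1 / 2)) = 0 := by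
  rw [cosPotential, arccos_neg_half]
  exact (h.eq_zero_iff _ ⟨by positivity, by linarith [pi_pos]⟩).2 (Or.inl rfl)

/-- The second zero `4π/3` of the potential is beyond the range of `arccos`. -/
theorem cosPotential_pos {v₃ : ℝ → ℝ} (h : IsThreeBodyPotential v₃) {x : ℝ} (hx : x ∈ Icc (-1 : ℝ) 1) (hx' : x ≠ -(1 / 2)) :
    0 < cosPotential v₃ x := by
  refine lt_of_le_of_ne (cosPotential_nonneg h x) fun h0 => hx' ?_
  rcases (h.eq_zero_iff _ ⟨arccos_nonneg x, by linarith [arccos_le_pi x, pi_pos]⟩).1 h0.symm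
    with h1 | h1
  · rw [← arccos_neg_half] at h1
    exact arccos_injOn hx ⟨by norm_num, by norm_num⟩ h1
  · linarith [arccos_le_pi x, pi_pos]

theorem smoothNear_threeBody {v₃ : ℝ → ℝ} (h : IsThreeBodyPotential v₃) {α : ℝ} (hα : α ∈ Ioo 0 (2 * π)) : SmoothNear v₃ α :=
  .of_contDiffOn isOpen_Ioo (h.smooth.mono Ioo_subset_Icc_self) hα

theorem smoothNear_arccos {x : ℝ} (hx : x ∈ Ioo (-1 : ℝ) 1) : SmoothNear arccos x := by
  filter_upwards [Ioo_mem_nhds hx.1 hx.2] with y hy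
  exact contDiffAt_arccos hy.1.ne' hy.2.ne

theorem smoothNear_cosPotential {v₃ : ℝ → ℝ} (h : IsThreeBodyPotential v₃) {x : ℝ} (hx : x ∈ Ioo (-1 : ℝ) 1) :
    SmoothNear (cosPotential v₃) x :=
  SmoothNear.comp (f := arccos) (h := v₃) (smoothNear_threeBody h ⟨arccos_pos.2 hx.2, by
    linarith [arccos_le_pi x, pi_pos]⟩) (smoothNear_arccos hx)

theorem deriv_threeBody {v₃ : ℝ → ℝ} (h : IsThreeBodyPotential v₃) : deriv v₃ (2 * π / 3) = 0 := by
  refine IsLocalMin.deriv_eq_zero ?_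
  filter_upwards [Icc_mem_nhds (show 0 < 2 * π / 3 by positivity)
    (show 2 * π / 3 < 2 * π by linarith [pi_pos])] with x hx
  rw [(h.eq_zero_iff _ ⟨by positivity, by linarith [pi_pos]⟩).2 (Or.inl rfl)]
  exact h.nonneg x hx

theorem deriv_cosPotential_neg_half {v₃ : ℝ → ℝ} (h : IsThreeBodyPotential v₃) : deriv (cosPotential v₃) (-(1 / 2)) = 0 := by
  refine IsLocalMin.deriv_eq_zero (Eventually.of_forall fun x => ?_)
  rw [cosPotential_neg_half h]
  exact cosPotential_nonneg h x

/-- Since `v₃'(2π/3) = 0`, only `v₃''` times the square of `arccos'` survives, and that square is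
`1/(1 - 1/4) = 4/3`. -/
theorem deriv_deriv_cosPotential_neg_half {v₃ : ℝ → ℝ} (h : IsThreeBodyPotential v₃) :
    deriv (deriv (cosPotential v₃)) (-(1 / 2)) = 4 / 3 * iteratedDeriv 2 v₃ (2 * π / 3) := by
  have hx : (-(1 / 2) : ℝ) ∈ Ioo (-1 : ℝ) 1 := ⟨by norm_num, by norm_num⟩
  have hα : arccos (-(1 / 2)) ∈ Ioo 0 (2 * π) := by
    rw [arccos_neg_half]; exact ⟨by positivity, by linarith [pi_pos]⟩
  have hv := smoothNear_threeBody h hα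
  have ha := smoothNear_arccos hx
  have h1 : deriv (cosPotential v₃) =ᶠ[𝓝 (-(1 / 2))]
      fun x => deriv v₃ (arccos x) * deriv arccos x := by
    filter_upwards [ha.eventually, ha.continuousAt.eventually hv.eventually] with x e1 e2
    exact (e2.hasDerivAt.comp x e1.hasDerivAt).deriv
  have h2 := (hv.deriv.hasDerivAt.comp _ ha.hasDerivAt).mul ha.deriv.hasDerivAt
  have h3 : deriv (fun x => deriv v₃ (arccos x) * deriv arccos x) (-(1 / 2)) = _ := h2.deriv
  rw [h1.deriv_eq, h3, Function.comp_apply, iteratedDeriv_two_eq, arccos_neg_half,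
    deriv_threeBody h, zero_mul, add_zero, mul_assoc, mul_comm]
  congr 1
  have : deriv arccos (-(1 / 2)) = -(1 / √(1 - (-(1 / 2)) ^ 2)) :=
    (hasDerivAt_arccos (by norm_num) (by norm_num)).deriv
  rw [this, neg_mul_neg, div_mul_div_comm, mul_self_sqrt (by norm_num)]
  norm_num

end Nanotube

end AngleEnergy

/-! ### The minimizer of the angle energy as `κ → 1` -/

section UnstretchedAngle

open Filter Topology

namespace Nanotube

/-- The cosine of the third bond angle. -/
theorem third_cos_mem {κ s : ℝ} (hκ : κ ∈ Ioo (0 : ℝ) 1) (hs : s ∈ Ioo (0 : ℝ) 1) :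
    s ^ 2 - κ * (1 - s ^ 2) ∈ Ioo (-1 : ℝ) 1 := by
  obtain ⟨h1, h2⟩ := hκ
  obtain ⟨h3, h4⟩ := hs
  have h5 : s ^ 2 < 1 := by nlinarith
  constructor <;> nlinarith [mul_pos h1 (sub_pos.2 h5), sq_nonneg s, mul_nonneg h1.le (sq_nonneg s)]

theorem smoothNear_angleEnergy {v₃ : ℝ → ℝ} (h : IsThreeBodyPotential v₃) {κ s : ℝ}
    (hκ : κ ∈ Ioo (0 : ℝ) 1) (hs : s ∈ Ioo (0 : ℝ) 1) : SmoothNear (angleEnergy v₃ κ) s := by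
  have h1 : SmoothNear (fun s => cosPotential v₃ (-s)) s :=
    SmoothNear.comp (f := fun s : ℝ => -s)
      (smoothNear_cosPotential h ⟨by linarith [hs.2], by linarith [hs.1]⟩)
      (.of_contDiff contDiff_neg)
  have h2 : SmoothNear (fun s => cosPotential v₃ (s ^ 2 - κ * (1 - s ^ 2))) s :=
    SmoothNear.comp (f := fun s : ℝ => s ^ 2 - κ * (1 - s ^ 2))
      (smoothNear_cosPotential h (third_cos_mem hκ hs)) (.of_contDiff (by fun_prop))
  exact ((SmoothNear.const 2).mul h1).add h2

theorem contDiffOn_angleEnergy {v₃ : ℝ → ℝ} (h : IsThreeBodyPotential v₃) {κ : ℝ}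
    (hκ : κ ∈ Ioo (0 : ℝ) 1) : ContDiffOn ℝ ∞ (angleEnergy v₃ κ) (Ioo 0 1) := fun _ hs =>
  (smoothNear_angleEnergy h hκ hs).contDiffAt.contDiffWithinAt

theorem hasDerivAt_angleEnergy {v₃ : ℝ → ℝ} (h : IsThreeBodyPotential v₃) {κ s : ℝ}
    (hκ : κ ∈ Ioo (0 : ℝ) 1) (hs : s ∈ Ioo (0 : ℝ) 1) :
    HasDerivAt (angleEnergy v₃ κ) (-2 * deriv (cosPotential v₃) (-s) +
      deriv (cosPotential v₃) (s ^ 2 - κ * (1 - s ^ 2)) * (2 * (1 + κ) * s)) s := by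
  have e1 : HasDerivAt (fun s : ℝ => s ^ 2 - κ * (1 - s ^ 2)) (2 * (1 + κ) * s) s := by
    have := ((hasDerivAt_pow 2 s).sub (((hasDerivAt_pow 2 s).const_sub 1).const_mul κ))
    refine this.congr_deriv ?_
    push_cast
    ring
  have e2 := (smoothNear_cosPotential h (x := -s)
    ⟨by linarith [hs.2], by linarith [hs.1]⟩).hasDerivAt.comp s (hasDerivAt_neg s)
  have e3 := (smoothNear_cosPotential h (third_cos_mem hκ hs)).hasDerivAt.comp s e1
  refine ((e2.const_mul 2).add e3).congr_deriv ?_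
  ring

/-- The second derivative of the contribution of the angles. -/
noncomputable def angleStiffness (v₃ : ℝ → ℝ) (κ s : ℝ) : ℝ :=
  2 * deriv (deriv (cosPotential v₃)) (-s) +
    (deriv (deriv (cosPotential v₃)) (s ^ 2 - κ * (1 - s ^ 2)) * (2 * (1 + κ) * s) ^ 2 +
      deriv (cosPotential v₃) (s ^ 2 - κ * (1 - s ^ 2)) * (2 * (1 + κ)))

theorem deriv_deriv_angleEnergy {v₃ : ℝ → ℝ} (h : IsThreeBodyPotential v₃) {κ s : ℝ}
    (hκ : κ ∈ Ioo (0 : ℝ) 1) (hs : s ∈ Ioo (0 : ℝ) 1) :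
    deriv (deriv (angleEnergy v₃ κ)) s = angleStiffness v₃ κ s := by
  have h1 : deriv (angleEnergy v₃ κ) =ᶠ[𝓝 s] fun s => -2 * deriv (cosPotential v₃) (-s) +
      deriv (cosPotential v₃) (s ^ 2 - κ * (1 - s ^ 2)) * (2 * (1 + κ) * s) := by
    filter_upwards [Ioo_mem_nhds hs.1 hs.2] with x hx
    exact (hasDerivAt_angleEnergy h hκ hx).deriv
  rw [h1.deriv_eq]
  have e1 : HasDerivAt (fun s : ℝ => s ^ 2 - κ * (1 - s ^ 2)) (2 * (1 + κ) * s) s := by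
    have := ((hasDerivAt_pow 2 s).sub (((hasDerivAt_pow 2 s).const_sub 1).const_mul κ))
    refine this.congr_deriv ?_
    push_cast
    ring
  have e2 := (smoothNear_cosPotential h (x := -s)
    ⟨by linarith [hs.2], by linarith [hs.1]⟩).deriv.hasDerivAt.comp s (hasDerivAt_neg s)
  have e3 := (smoothNear_cosPotential h (third_cos_mem hκ hs)).deriv.hasDerivAt.comp s e1
  have e4 : HasDerivAt (fun s : ℝ => 2 * (1 + κ) * s) (2 * (1 + κ) * 1) s :=
    (hasDerivAt_id s).const_mul _
  have e5 := (e2.const_mul (-2)).add (e3.mul e4)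
  refine (HasDerivAt.deriv (f := fun s => -2 * deriv (cosPotential v₃) (-s) +
      deriv (cosPotential v₃) (s ^ 2 - κ * (1 - s ^ 2)) * (2 * (1 + κ) * s)) e5).trans ?_
  simp only [angleStiffness, Function.comp_apply]
  ring

/-- Continuity jointly in `κ` and `s` carries the strict bounds of the flat limit `κ = 1`, `s = 1/2`
over to all large `ℓ`. -/
theorem continuousAt_angleStiffness {v₃ : ℝ → ℝ} (h : IsThreeBodyPotential v₃) :
    ContinuousAt (fun z : ℝ × ℝ => angleStiffness v₃ z.1 z.2) (1, 1 / 2) := by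
  have hx : SmoothNear (cosPotential v₃) (-(1 / 2)) :=
    smoothNear_cosPotential h ⟨by norm_num, by norm_num⟩
  have c1 : ContinuousAt (fun z : ℝ × ℝ => -z.2) (1, 1 / 2) := by fun_prop
  have c2 : ContinuousAt (fun z : ℝ × ℝ => z.2 ^ 2 - z.1 * (1 - z.2 ^ 2)) (1, 1 / 2) := by fun_prop
  have c3 : ContinuousAt (fun z : ℝ × ℝ => 2 * (1 + z.1) * z.2) (1, 1 / 2) := by fun_prop
  have c4 : ContinuousAt (fun z : ℝ × ℝ => 2 * (1 + z.1)) (1, 1 / 2) := by fun_prop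
  have f1 : (fun z : ℝ × ℝ => -z.2) (1, 1 / 2) = -(1 / 2) := rfl
  have f2 : (fun z : ℝ × ℝ => z.2 ^ 2 - z.1 * (1 - z.2 ^ 2)) (1, 1 / 2) = -(1 / 2) := by norm_num
  have d1 := hx.deriv.deriv.continuousAt.comp_of_eq c1 f1
  have d2 := hx.deriv.deriv.continuousAt.comp_of_eq c2 f2
  have d3 := hx.deriv.continuousAt.comp_of_eq c2 f2
  exact (d1.const_mul 2).add ((d2.mul (c3.pow 2)).add (d3.mul c4))

/-- In the flat limit all three cosines are `-1/2`, so the first-order term drops out and `(4/3)(2 +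
4) = 8`. -/
theorem angleStiffness_one_half {v₃ : ℝ → ℝ} (h : IsThreeBodyPotential v₃) :
    angleStiffness v₃ 1 (1 / 2) = 8 * iteratedDeriv 2 v₃ (2 * π / 3) := by
  have f2 : ((1 : ℝ) / 2) ^ 2 - 1 * (1 - (1 / 2) ^ 2) = -(1 / 2) := by norm_num
  rw [angleStiffness, f2, deriv_cosPotential_neg_half h, deriv_deriv_cosPotential_neg_half h]
  ring

/-- A function that is strictly convex near a critical point has a strict minimum there. -/
theorem lt_of_deriv_eq_zero {f : ℝ → ℝ} {a b x : ℝ} (hf : ContinuousOn f (Ioo a b))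
    (h2 : ∀ y ∈ Ioo a b, 0 < deriv (deriv f) y) (hx : x ∈ Ioo a b) (h1 : deriv f x = 0)
    {y : ℝ} (hy : y ∈ Ioo a b) (hyx : y ≠ x) : f x < f y := by
  have hc : StrictConvexOn ℝ (Ioo a b) f := strictConvexOn_of_deriv2_pos' (convex_Ioo _ _) hf h2
  have hm : IsMinOn f (Ioo a b) x := IsMinOn.of_isLocalMinOn_of_convexOn hx
    ((isLocalMin_of_deriv_deriv_pos (h2 x hx) h1
      (hf.continuousAt (Ioo_mem_nhds hx.1 hx.2))).on _) hc.convexOn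
  refine lt_of_le_of_ne (hm hy) fun he => hyx ?_
  refine hc.eq_of_isMinOn (fun z hz => ?_) hm hy hx
  change f y ≤ f z
  rw [← he]
  exact hm hz

/-- At this slope the third cosine is again `-s`, so with `V = cosPotential v₃` the derivative
collapses to `-2 (1 - κ) V'(-s)`. -/
theorem deriv_angleEnergy_polyhedral_neg {v₃ : ℝ → ℝ} (h : IsThreeBodyPotential v₃) {κ : ℝ}
    (hκ : κ ∈ Ioo (0 : ℝ) 1) (hV : 0 < deriv (cosPotential v₃) (-(κ / (1 + κ)))) :
    deriv (angleEnergy v₃ κ) (κ / (1 + κ)) < 0 := by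
  have h0 : 0 < 1 + κ := by linarith [hκ.1]
  rw [(hasDerivAt_angleEnergy h hκ ⟨div_pos hκ.1 h0, (div_lt_one h0).2 (by linarith)⟩).deriv]
  have e1 : (κ / (1 + κ)) ^ 2 - κ * (1 - (κ / (1 + κ)) ^ 2) = -(κ / (1 + κ)) := by
    field_simp
    ring
  have e2 : 2 * (1 + κ) * (κ / (1 + κ)) = 2 * κ := by field_simp
  rw [e1, e2]
  nlinarith [mul_pos hV (sub_pos.2 hκ.2)]

/-- At `s = 1/2` two of the angles are at their optimum, and only the third one contributes to the
derivative. -/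
theorem deriv_angleEnergy_half_pos {v₃ : ℝ → ℝ} (h : IsThreeBodyPotential v₃) {κ : ℝ}
    (hκ : κ ∈ Ioo (0 : ℝ) 1) (hV : 0 < deriv (cosPotential v₃) (1 / 4 - 3 / 4 * κ)) :
    0 < deriv (angleEnergy v₃ κ) (1 / 2) := by
  rw [(hasDerivAt_angleEnergy h hκ ⟨by norm_num, by norm_num⟩).deriv,
    deriv_cosPotential_neg_half h,
    show ((1 : ℝ) / 2) ^ 2 - κ * (1 - (1 / 2) ^ 2) = 1 / 4 - 3 / 4 * κ by ring]
  have : 0 < 1 + κ := by linarith [hκ.1]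
  have : 0 < deriv (cosPotential v₃) (1 / 4 - 3 / 4 * κ) * (2 * (1 + κ) * (1 / 2)) := by positivity
  linarith

/-- For `κ` close to `1`, the contribution of the angles has a unique minimizer, which lies between
the polyhedral and the rolled-up one. -/
theorem eventually_exists_unstretched {v₃ : ℝ → ℝ} (h : IsThreeBodyPotential v₃) (a : ℝ) :
    ∀ᶠ κ in 𝓝[<] (1 : ℝ), ∃ s₀ ∈ Ioo (κ / (1 + κ)) (1 / 2), s₀ ∈ Ioo (0.3 : ℝ) 0.55 ∧
      (∀ s ∈ Icc (0.18 : ℝ) 0.73, s ≠ s₀ → angleEnergy v₃ κ s₀ < angleEnergy v₃ κ s) ∧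
      4 * iteratedDeriv 2 v₃ (2 * π / 3) < deriv (deriv (angleEnergy v₃ κ)) s₀ ∧
      deriv (deriv (angleEnergy v₃ κ)) s₀ < 12 * iteratedDeriv 2 v₃ (2 * π / 3) ∧
      (a < 6 * iteratedDeriv 2 v₃ (2 * π / 3) →
        a < deriv (deriv (angleEnergy v₃ κ)) s₀ * (1 - s₀ ^ 2)) ∧
      (6 * iteratedDeriv 2 v₃ (2 * π / 3) < a →
        deriv (deriv (angleEnergy v₃ κ)) s₀ * (1 - s₀ ^ 2) < a) := by
  have hb := h.second_deriv_pos
  have hA := deriv_deriv_cosPotential_neg_half h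
  have hC := angleStiffness_one_half h
  set B := iteratedDeriv 2 v₃ (2 * π / 3)
  have hc := continuousAt_angleStiffness h
  have hc' : ContinuousAt (fun z : ℝ × ℝ => angleStiffness v₃ z.1 z.2 * (1 - z.2 ^ 2))
      (1, 1 / 2) := hc.mul (by fun_prop)
  -- The origin of the threshold in the statement on the radius: `8 B (1 - 1/4) = 6 B`.
  have hval : angleStiffness v₃ 1 (1 / 2) * (1 - (1 / 2) ^ 2) = 6 * B := by rw [hC]; ring
  have hP : ∀ᶠ z : ℝ × ℝ in 𝓝 (1, 1 / 2),
      (4 * B < angleStiffness v₃ z.1 z.2 ∧ angleStiffness v₃ z.1 z.2 < 12 * B) ∧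
      (a < 6 * B → a < angleStiffness v₃ z.1 z.2 * (1 - z.2 ^ 2)) ∧
      (6 * B < a → angleStiffness v₃ z.1 z.2 * (1 - z.2 ^ 2) < a) := by
    refine ((hc.eventually_const_lt (by simp only [hC]; linarith)).and
      (hc.eventually_lt_const (by simp only [hC]; linarith))).and (.and ?_ ?_)
    · by_cases ha : a < 6 * B
      · exact (hc'.eventually_const_lt (by simpa only [hval] using ha)).mono fun _ h _ => h
      · exact Eventually.of_forall fun _ h => absurd h ha
    · by_cases ha : 6 * B < a
      · exact (hc'.eventually_lt_const (by simpa only [hval] using ha)).mono fun _ h _ => h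
      · exact Eventually.of_forall fun _ h => absurd h ha
  obtain ⟨ε, hε, hP⟩ := Metric.eventually_nhds_iff.1 hP
  -- The bound `0.05` keeps the neighbourhood of `1/2` within `[0.45, 0.55]`, hence within the range
  -- required of `s₀`.
  obtain ⟨δ, hδ0, hδε, hδ⟩ : ∃ δ : ℝ, 0 < δ ∧ δ ≤ ε ∧ δ ≤ 0.05 :=
    ⟨min ε 0.05, lt_min hε (by norm_num), min_le_left _ _, min_le_right _ _⟩
  -- the derivative of the potential is positive to the right of `-1/2`
  have hVs : SmoothNear (cosPotential v₃) (-(1 / 2)) :=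
    smoothNear_cosPotential h ⟨by norm_num, by norm_num⟩
  obtain ⟨r, hmono, hr⟩ := ((hVs.deriv.eventually_strictMonoOn (by rw [hA]; positivity)).and
    (eventually_mem_nhdsWithin (a := (0 : ℝ)) (s := Ioi 0))).exists
  have hr : 0 < r := hr
  have hVpos : ∀ x ∈ Ioo (-(1 / 2) : ℝ) (-(1 / 2) + r), 0 < deriv (cosPotential v₃) x := by
    intro x hx
    have := hmono (a := -(1 / 2)) ⟨by linarith, by linarith⟩ ⟨by linarith [hx.1], hx.2⟩ hx.1
    rwa [deriv_cosPotential_neg_half h] at this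
  -- the energy is bounded from below away from `1/2`
  have hK : IsCompact (Icc (0.18 : ℝ) 0.73 \ Ioo (1 / 2 - δ) (1 / 2 + δ)) :=
    isCompact_Icc.diff isOpen_Ioo
  obtain ⟨η, hη0, hη⟩ := hK.exists_forall_le' (f := fun s => cosPotential v₃ (-s)) (a := 0)
    (fun s hs => by
      have : ContinuousAt (fun s : ℝ => cosPotential v₃ (-s)) s :=
        (smoothNear_cosPotential h ⟨by linarith [hs.1.2], by linarith [hs.1.1]⟩
          ).continuousAt.comp_of_eq continuousAt_neg rfl
      exact this.continuousWithinAt)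
    (fun s hs => by
      refine cosPotential_pos h ⟨by linarith [hs.1.2], by linarith [hs.1.1]⟩ fun he => hs.2 ?_
      have : s = 1 / 2 := by linarith
      rw [this]
      constructor <;> linarith)
  have hsmall : ∀ᶠ κ in 𝓝 (1 : ℝ), cosPotential v₃ (1 / 4 - 3 / 4 * κ) < 2 * η := by
    have e1 : ContinuousAt (fun κ : ℝ => 1 / 4 - 3 / 4 * κ) 1 := by fun_prop
    have e2 := hVs.continuousAt.comp_of_eq e1 (by norm_num)
    refine e2.eventually_lt_const ?_
    rw [Function.comp_apply, show (1 : ℝ) / 4 - 3 / 4 * 1 = -(1 / 2) by norm_num,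
      cosPotential_neg_half h]
    linarith
  have hnear : ∀ᶠ κ in 𝓝 (1 : ℝ), 1 - min δ r < κ :=
    lt_mem_nhds (by linarith [lt_min hδ0 hr])
  filter_upwards [hsmall.filter_mono nhdsWithin_le_nhds, hnear.filter_mono nhdsWithin_le_nhds,
    self_mem_nhdsWithin] with κ k1 k2 k3
  have k3 : κ < 1 := k3
  have k4 : 1 - δ < κ := by linarith [min_le_left δ r]
  have k5 : 1 - r < κ := by linarith [min_le_right δ r]
  have hκ : κ ∈ Ioo (0 : ℝ) 1 := ⟨by linarith, k3⟩
  have h1κ : 0 < 1 + κ := by linarith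
  have hch : κ / (1 + κ) < 1 / 2 := by rw [div_lt_div_iff₀ h1κ two_pos]; linarith
  have hch1 : 1 / 2 - δ < κ / (1 + κ) := by
    rw [lt_div_iff₀ h1κ]; nlinarith
  have hch2 : 1 / 2 - r < κ / (1 + κ) := by
    rw [lt_div_iff₀ h1κ]; nlinarith
  have hI : ∀ s ∈ Ioo (1 / 2 - δ) (1 / 2 + δ), s ∈ Ioo (0 : ℝ) 1 := fun s hs =>
    ⟨by linarith [hs.1], by linarith [hs.2]⟩
  have hPI : ∀ s ∈ Ioo (1 / 2 - δ) (1 / 2 + δ), dist (κ, s) (1, 1 / 2) < ε := by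
    intro s hs
    rw [Prod.dist_eq, max_lt_iff, Real.dist_eq, Real.dist_eq, abs_lt, abs_lt]
    refine ⟨⟨?_, ?_⟩, ?_, ?_⟩ <;> simp only <;> linarith [hs.1, hs.2]
  have hg : ContinuousOn (deriv (angleEnergy v₃ κ)) (Icc (κ / (1 + κ)) (1 / 2)) := fun s hs =>
    (smoothNear_angleEnergy h hκ
      (hI s ⟨by linarith [hs.1], by linarith [hs.2]⟩)).deriv.continuousAt.continuousWithinAt
  -- The derivative changes sign between the polyhedral and the rolled-up slope.
  obtain ⟨s₀, hs₀, hs₀d⟩ := intermediate_value_Ioo hch.le hg (show (0 : ℝ) ∈ _ from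
    ⟨deriv_angleEnergy_polyhedral_neg h hκ (hVpos _ ⟨by linarith, by linarith⟩),
      deriv_angleEnergy_half_pos h hκ (hVpos _ ⟨by linarith, by linarith⟩)⟩)
  have hs₀I : s₀ ∈ Ioo (1 / 2 - δ) (1 / 2 + δ) := ⟨by linarith [hs₀.1], by linarith [hs₀.2]⟩
  have hdd : ∀ s ∈ Ioo (1 / 2 - δ) (1 / 2 + δ),
      deriv (deriv (angleEnergy v₃ κ)) s = angleStiffness v₃ κ s := fun s hs =>
    deriv_deriv_angleEnergy h hκ (hI s hs)
  have hPs := hP (hPI s₀ hs₀I)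
  rw [← hdd s₀ hs₀I] at hPs
  refine ⟨s₀, hs₀, ⟨by linarith [hs₀I.1], by linarith [hs₀.2]⟩, ?_, hPs.1.1, hPs.1.2, hPs.2.1,
    hPs.2.2⟩
  have hloc : ∀ s ∈ Ioo (1 / 2 - δ) (1 / 2 + δ), s ≠ s₀ →
      angleEnergy v₃ κ s₀ < angleEnergy v₃ κ s := fun s hs hne =>
    lt_of_deriv_eq_zero
      (fun y hy => (smoothNear_angleEnergy h hκ (hI y hy)).continuousAt.continuousWithinAt)
      (fun y hy => by
        rw [hdd y hy]
        linarith [(hP (hPI y hy)).1.1]) hs₀I hs₀d hs hne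
  intro s hs hne
  by_cases hsI : s ∈ Ioo (1 / 2 - δ) (1 / 2 + δ)
  · exact hloc s hsI hne
  -- Away from `1/2` the comparison passes through the rolled-up slope, whose energy is below `2η`,
  -- while the two equal angles at `s` alone already cost `2η`.
  · have e1 : angleEnergy v₃ κ s₀ < angleEnergy v₃ κ (1 / 2) :=
      hloc _ ⟨by linarith, by linarith⟩ hs₀.2.ne'
    have e2 : angleEnergy v₃ κ (1 / 2) = cosPotential v₃ (1 / 4 - 3 / 4 * κ) := by
      rw [angleEnergy, cosPotential_neg_half h,
        show ((1 : ℝ) / 2) ^ 2 - κ * (1 - (1 / 2) ^ 2) = 1 / 4 - 3 / 4 * κ by ring]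
      ring
    have e3 : η ≤ cosPotential v₃ (-s) := hη s ⟨hs, hsI⟩
    have e4 := cosPotential_nonneg h (s ^ 2 - κ * (1 - s ^ 2))
    have e5 : angleEnergy v₃ κ s =
      2 * cosPotential v₃ (-s) + cosPotential v₃ (s ^ 2 - κ * (1 - s ^ 2)) := rfl
    linarith

end Nanotube

end UnstretchedAngle

section ConfigurationalEnergy

namespace Nanotube

/-! ## Bonds modulo the period -/

theorem perDist_comm (L : ℝ) (x y : Space) : perDist L x y = perDist L y x := by
  have e1 : ‖x - y + L • e₁‖ = ‖y - x - L • e₁‖ := by rw [← norm_neg]; congr 1; abel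
  have e2 : ‖x - y - L • e₁‖ = ‖y - x + L • e₁‖ := by rw [← norm_neg]; congr 1; abel
  rw [perDist, perDist, norm_sub_rev x y, e1, e2, min_comm ‖y - x - L • e₁‖]

theorem bonds_symm {C : Set Space} {L : ℝ} {x y : Space} (h : (x, y) ∈ bonds C L) :
    (y, x) ∈ bonds C L :=
  ⟨h.2.1, h.1, h.2.2.1.symm, by rw [perDist_comm]; exact h.2.2.2⟩

/-- The energy of a configuration all of whose atoms have the same three-fold environment. -/
theorem configEnergy_eq_of_threefold {ι : Type*} {v₂ v₃ : ℝ → ℝ} {C : Set Space} {L : ℝ}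
    {I : Finset ι} {P : ι → Space} (hP : InjOn P I) (hC : C = P '' I) {nb : ι → Fin 3 → Space}
    (hinj : ∀ a ∈ I, Function.Injective (nb a))
    (hb : ∀ a ∈ I, ∀ x, (x, P a) ∈ bonds C L ↔ ∃ i, x = nb a i)
    {d : Fin 3 → ℝ} (hd : ∀ a ∈ I, ∀ i, perDist L (nb a i) (P a) = d i) {w : Fin 3 → Fin 3 → ℝ}
    (hw : ∀ a ∈ I, ∀ i j, i ≠ j → v₃ (bondAngle L (nb a i) (P a) (nb a j)) = w i j) :
    configEnergy v₂ v₃ C L = 1 / 2 * (I.card * ∑ i, v₂ (d i)) +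
      1 / 2 * (I.card * ∑ ij ∈ (Finset.univ : Finset (Fin 3)).offDiag, w ij.1 ij.2) := by
  classical
  have hB : bonds C L = (fun q : ι × Fin 3 => (nb q.1 q.2, P q.1)) ''
      (I ×ˢ (Finset.univ : Finset (Fin 3)) : Finset (ι × Fin 3)) := by
    ext ⟨x, y⟩
    constructor
    · intro h
      have hy : y ∈ C := h.2.1
      rw [hC] at hy
      obtain ⟨a, ha, rfl⟩ := hy
      obtain ⟨i, rfl⟩ := (hb a ha x).1 h
      exact ⟨(a, i), by simpa using ha, rfl⟩
    · rintro ⟨⟨a, i⟩, ha, he⟩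
      have ha : a ∈ I := by simpa using ha
      rw [← he]
      exact (hb a ha _).2 ⟨i, rfl⟩
  -- Ordered pairs of different neighbours: each angle occurs twice, which the factor `1/2` of the
  -- energy compensates.
  have hT : triples C L = (fun q : ι × (Fin 3 × Fin 3) => (nb q.1 q.2.1, P q.1, nb q.1 q.2.2)) ''
      (I ×ˢ (Finset.univ : Finset (Fin 3)).offDiag : Finset (ι × (Fin 3 × Fin 3))) := by
    ext ⟨x, y, z⟩
    constructor
    · rintro ⟨hne, h1, h2⟩
      have hy : y ∈ C := h1.2.1
      rw [hC] at hy
      obtain ⟨a, ha, rfl⟩ := hy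
      obtain ⟨i, rfl⟩ := (hb a ha x).1 h1
      obtain ⟨j, rfl⟩ := (hb a ha z).1 (bonds_symm h2)
      refine ⟨(a, i, j), ?_, rfl⟩
      have : i ≠ j := fun h => hne (by simp [h])
      simpa [this] using ha
    · rintro ⟨⟨a, i, j⟩, ha, he⟩
      have ha : a ∈ I ∧ i ≠ j := by simpa using ha
      rw [← he]
      exact ⟨fun h => ha.2 (hinj a ha.1 h), (hb a ha.1 _).2 ⟨i, rfl⟩,
        bonds_symm ((hb a ha.1 _).2 ⟨j, rfl⟩)⟩
  have iB : InjOn (fun q : ι × Fin 3 => (nb q.1 q.2, P q.1))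
      (I ×ˢ (Finset.univ : Finset (Fin 3)) : Finset (ι × Fin 3)) := by
    rintro ⟨a, i⟩ ha ⟨b, j⟩ hb' he
    have ha : a ∈ I := by simpa using ha
    have hb' : b ∈ I := by simpa using hb'
    simp only [Prod.mk.injEq] at he
    obtain rfl := hP ha hb' he.2
    rw [hinj a ha he.1]
  have iT : InjOn (fun q : ι × (Fin 3 × Fin 3) => (nb q.1 q.2.1, P q.1, nb q.1 q.2.2))
      (I ×ˢ (Finset.univ : Finset (Fin 3)).offDiag : Finset (ι × (Fin 3 × Fin 3))) := by
    rintro ⟨a, i, j⟩ ha ⟨b, i', j'⟩ hb' he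
    have ha : a ∈ I ∧ i ≠ j := by simpa using ha
    have hb' : b ∈ I ∧ i' ≠ j' := by simpa using hb'
    simp only [Prod.mk.injEq] at he
    obtain rfl := hP ha.1 hb'.1 he.2.1
    rw [hinj a ha.1 he.1, hinj a ha.1 he.2.2]
  rw [configEnergy, hB, hT, finsum_mem_image iB, finsum_mem_image iT, finsum_mem_coe_finset,
    finsum_mem_coe_finset, Finset.sum_product, Finset.sum_product]
  congr 2
  · rw [← nsmul_eq_mul, ← Finset.sum_const]
    exact Finset.sum_congr rfl fun a ha => Finset.sum_congr rfl fun i _ => by rw [hd a ha i]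
  · rw [← nsmul_eq_mul, ← Finset.sum_const]
    refine Finset.sum_congr rfl fun a ha => Finset.sum_congr rfl fun ij hij => ?_
    exact hw a ha _ _ (by simpa using hij)

theorem norm_e₁ : ‖e₁‖ = 1 := by
  rw [EuclideanSpace.norm_eq, e₁]
  simp [Fin.sum_univ_three]

/-- A short representative of a difference of atoms is the bond vector. -/
theorem perVec_eq {L : ℝ} (hL : 2.6 ≤ L) {x y v : Space} (hv : ‖v‖ < 1.1)
    (h : v = x - y ∨ v = x - y + L • e₁ ∨ v = x - y - L • e₁) :
    perVec L x y = v ∧ perDist L x y = ‖v‖ := by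
  have hn : ‖L • e₁‖ = L := by
    rw [norm_smul, norm_e₁, mul_one, Real.norm_of_nonneg (by linarith)]
  -- All other images are longer than `v`, because `L ≥ 2.6` exceeds twice `1.1`. Translates by two
  -- periods occur too, as `v` may itself be a translate of `x - y`.
  have h1 : L - ‖v‖ ≤ ‖v + L • e₁‖ := by
    have := norm_sub_norm_le (L • e₁) (-v)
    rw [norm_neg, hn, sub_neg_eq_add, add_comm (L • e₁)] at this
    exact this
  have h2 : L - ‖v‖ ≤ ‖v - L • e₁‖ := by
    have := norm_sub_norm_le (L • e₁) v
    rwa [hn, norm_sub_rev] at this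
  have h3 : 2 * L - ‖v‖ ≤ ‖v + L • e₁ + L • e₁‖ := by
    have := norm_sub_norm_le (L • e₁ + L • e₁) (-v)
    rw [norm_neg, sub_neg_eq_add, ← two_smul ℝ (L • e₁), norm_smul, hn, Real.norm_two,
      add_comm, two_smul, ← add_assoc] at this
    exact this
  have h4 : 2 * L - ‖v‖ ≤ ‖v - L • e₁ - L • e₁‖ := by
    have := norm_sub_norm_le (L • e₁ + L • e₁) v
    rw [← two_smul ℝ (L • e₁), norm_smul, hn, Real.norm_two, norm_sub_rev, two_smul,
      ← sub_sub] at this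
    exact this
  have h5 : ‖v + L • e₁‖ ≤ ‖v‖ + L := by
    have := norm_add_le v (L • e₁)
    rwa [hn] at this
  rcases h with rfl | h | h
  · rw [perVec, perDist, if_neg (by linarith), if_neg (by linarith)]
    exact ⟨rfl, min_eq_left (le_min (by linarith) (by linarith))⟩
  · have e1 : x - y = v - L • e₁ := by rw [h]; abel
    have e2 : v - L • e₁ + L • e₁ = v := by abel
    rw [perVec, perDist, e1, e2, if_pos (by linarith)]
    exact ⟨rfl, by
      rw [min_eq_right ((min_le_left _ _).trans (by linarith)), min_eq_left (by linarith)]⟩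
  · have e1 : x - y = v + L • e₁ := by rw [h]; abel
    have e2 : v + L • e₁ - L • e₁ = v := by abel
    rw [perVec, perDist, e1, e2, if_neg (by linarith), if_pos (by linarith)]
    exact ⟨rfl, by
      rw [min_eq_right ((min_le_right _ _).trans (by linarith)), min_eq_right (by linarith)]⟩

theorem perDist_lt_iff {L c : ℝ} {x y : Space} :
    perDist L x y < c ↔ ‖x - y‖ < c ∨ ‖x - y + L • e₁‖ < c ∨ ‖x - y - L • e₁‖ < c := by
  rw [perDist, min_lt_iff, min_lt_iff]

end Nanotube

end ConfigurationalEnergy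

section TubeGeometry

namespace Nanotube

/-! ## The geometry of zigzag nanotubes -/

/-- The atoms of a zigzag nanotube are those `atom ℓ μ σ ρ t e r` with `e ∈ {0, 1}` and
`r ≡ t + e` modulo `2`. -/
noncomputable def atom (ℓ : ℕ) (μ σ ρ : ℝ) (t e r : ℤ) : Space :=
  !₂[t * (μ / 2) + e * σ, ρ * cos (π * r / ℓ), ρ * sin (π * r / ℓ)]

/-- The relations between the parameters of a zigzag nanotube. -/
structure IsTubeData (ℓ : ℕ) (μ lam₁ lam₂ σ ρ : ℝ) : Prop where
  four_le : 4 ≤ ℓ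
  period_mem : μ ∈ Ioo (2.6 : ℝ) 3.1
  lam₁_mem : lam₁ ∈ Ioo (0.9 : ℝ) 1.1
  lam₂_mem : lam₂ ∈ Ioo (0.9 : ℝ) 1.1
  sigma_eq : σ = μ / 2 - lam₁
  radius_eq : ρ ^ 2 * (2 - 2 * cos (π / ℓ)) = lam₂ ^ 2 - σ ^ 2

theorem cos_add_multiple {ℓ : ℕ} (hℓ : 0 < ℓ) (d k : ℤ) :
    cos (π * (d + 2 * ℓ * k : ℤ) / ℓ) = cos (π * d / ℓ) := by
  have h : (ℓ : ℝ) ≠ 0 := by positivity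
  rw [← cos_add_int_mul_two_pi (π * d / ℓ) k]
  congr 1
  push_cast
  field_simp

theorem sin_add_multiple {ℓ : ℕ} (hℓ : 0 < ℓ) (d k : ℤ) :
    sin (π * (d + 2 * ℓ * k : ℤ) / ℓ) = sin (π * d / ℓ) := by
  have h : (ℓ : ℝ) ≠ 0 := by positivity
  rw [← sin_add_int_mul_two_pi (π * d / ℓ) k]
  congr 1
  push_cast
  field_simp

/-- The cosine is even, has period `2ℓ` in `d` and decreases on the first half-turn; thus an angular
separation of at least `j` steps gives at least the chord of `j` steps. -/
theorem cos_le_cos_of_emod {ℓ : ℕ} (hℓ : 0 < ℓ) {d j : ℤ} (hj : 0 ≤ j) (h1 : j ≤ d % (2 * ℓ))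
    (h2 : d % (2 * ℓ) ≤ 2 * ℓ - j) : cos (π * d / ℓ) ≤ cos (π * j / ℓ) := by
  have h0 : (0 : ℝ) < ℓ := by positivity
  have hd : d = d % (2 * ℓ) + 2 * ℓ * (d / (2 * ℓ)) := (Int.emod_add_mul_ediv d (2 * ℓ)).symm
  rw [hd, cos_add_multiple hℓ]
  generalize d % (2 * ℓ) = d' at *
  have h1' : (j : ℝ) ≤ d' := by exact_mod_cast h1
  have h2' : (d' : ℝ) ≤ 2 * ℓ - j := by exact_mod_cast h2
  have hj' : (0 : ℝ) ≤ j := by exact_mod_cast hj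
  rcases le_total (d' : ℝ) ℓ with h | h
  · refine cos_le_cos_of_nonneg_of_le_pi (by positivity) ?_ ?_
    · rw [div_le_iff₀ h0]; exact mul_le_mul_of_nonneg_left h pi_pos.le
    · gcongr
  · have e : cos (π * d' / ℓ) = cos (π * (2 * ℓ - d') / ℓ) := by
      rw [← cos_two_pi_sub]; congr 1; field_simp
    rw [e]
    refine cos_le_cos_of_nonneg_of_le_pi (by positivity) ?_ ?_
    · rw [div_le_iff₀ h0]; exact mul_le_mul_of_nonneg_left (by linarith) pi_pos.le
    · gcongr; linarith

theorem atom_add_multiple {ℓ : ℕ} (hℓ : 0 < ℓ) (μ σ ρ : ℝ) (t e r k : ℤ) :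
    atom ℓ μ σ ρ t e (r + 2 * ℓ * k) = atom ℓ μ σ ρ t e r := by
  rw [atom, atom, cos_add_multiple hℓ, sin_add_multiple hℓ]

theorem atom_congr {ℓ : ℕ} (hℓ : 0 < ℓ) (μ σ ρ : ℝ) (t e : ℤ) {r r' : ℤ}
    (h : 2 * (ℓ : ℤ) ∣ r' - r) : atom ℓ μ σ ρ t e r' = atom ℓ μ σ ρ t e r := by
  obtain ⟨k, hk⟩ := h
  rw [show r' = r + 2 * ℓ * k by linarith, atom_add_multiple hℓ]

/-- The index `t` counts half periods, so `2m` steps are one length of the cell. -/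
theorem atom_add_period (ℓ m : ℕ) (μ σ ρ : ℝ) (t e r k : ℤ) :
    atom ℓ μ σ ρ (t + 2 * m * k) e r = atom ℓ μ σ ρ t e r + (k : ℝ) • ((m * μ) • e₁) := by
  ext i
  fin_cases i
  · simp [atom, e₁]
    ring
  · simp [atom, e₁]
  · simp [atom, e₁]

theorem norm_sq_atom_sub (ℓ : ℕ) (μ σ ρ : ℝ) (t e r t' e' r' : ℤ) :
    ‖atom ℓ μ σ ρ t' e' r' - atom ℓ μ σ ρ t e r‖ ^ 2 =
      ((t' - t : ℤ) * (μ / 2) + (e' - e : ℤ) * σ) ^ 2 +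
        ρ ^ 2 * (2 - 2 * cos (π * (r' - r : ℤ) / ℓ)) := by
  have h : π * (r' - r : ℤ) / ℓ = π * r' / ℓ - π * r / ℓ := by push_cast; ring
  rw [EuclideanSpace.norm_sq_eq, Fin.sum_univ_three, h, cos_sub]
  simp only [atom, PiLp.sub_apply, Matrix.cons_val_zero, Matrix.cons_val_one,
    Matrix.cons_val, Real.norm_eq_abs, sq_abs]
  have h1 := sin_sq_add_cos_sq (π * r' / ℓ)
  have h2 := sin_sq_add_cos_sq (π * r / ℓ)
  push_cast
  linear_combination ρ ^ 2 * h1 + ρ ^ 2 * h2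

/-- The indices of the three neighbours of an atom. -/
def neighborIndex (t e r : ℤ) : Fin 3 → ℤ × ℤ × ℤ :=
  ![(t - (1 - 2 * e), 1 - e, r), (t, 1 - e, r + 1), (t, 1 - e, r - 1)]

namespace IsTubeData

variable {ℓ : ℕ} {μ lam₁ lam₂ σ ρ : ℝ}

theorem pos (h : IsTubeData ℓ μ lam₁ lam₂ σ ρ) : 0 < ℓ := by have := h.four_le; omega

theorem sigma_mem (h : IsTubeData ℓ μ lam₁ lam₂ σ ρ) : σ ∈ Ioo (0.2 : ℝ) 0.65 := by
  obtain ⟨⟨-, h1, h2⟩, ⟨h3, h4⟩⟩ := And.intro (And.intro trivial h.period_mem) h.lam₁_mem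
  rw [h.sigma_eq]
  constructor <;> linarith

theorem cos_ge (h : IsTubeData ℓ μ lam₁ lam₂ σ ρ) : 0.7 ≤ cos (π / ℓ) := by
  have h4 : (4 : ℝ) ≤ ℓ := by exact_mod_cast h.four_le
  have h1 : cos (π / 4) ≤ cos (π / ℓ) := by
    refine cos_le_cos_of_nonneg_of_le_pi (by positivity) (by linarith [pi_pos]) ?_
    gcongr
  rw [cos_pi_div_four] at h1
  have : (1.4 : ℝ) ≤ √2 := le_sqrt_of_sq_le (by norm_num)
  linarith

/-- The squared chord of one angular step is `λ₂² - σ² > 0.9² - 0.65²`. -/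
theorem cross_section_gt (h : IsTubeData ℓ μ lam₁ lam₂ σ ρ) :
    0.38 < ρ ^ 2 * (2 - 2 * cos (π / ℓ)) := by
  have h1 := h.sigma_mem
  have h2 := h.lam₂_mem
  rw [h.radius_eq]
  nlinarith [h1.1, h1.2, h2.1, h2.2]

/-- The angular separation of distinct atoms in a common cross-section. -/
theorem dvd_of_even (h : IsTubeData ℓ μ lam₁ lam₂ σ ρ) {d : ℤ} (hd : 2 ∣ d)
    (hlt : ρ ^ 2 * (2 - 2 * cos (π * d / ℓ)) < 1.21) : 2 * (ℓ : ℤ) ∣ d := by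
  by_contra hcon
  have hpos : (0 : ℤ) < 2 * ℓ := by have := h.pos; omega
  have h0 : d % (2 * ℓ) ≠ 0 := fun h0 => hcon (Int.dvd_of_emod_eq_zero h0)
  have h1 := Int.emod_nonneg d hpos.ne'
  have h2 := Int.emod_lt_of_pos d hpos
  have h3 : d % (2 * ℓ) % 2 = d % 2 := Int.emod_emod_of_dvd d (Dvd.intro _ rfl)
  -- Otherwise the separation is at least two steps, and the squared chord of two steps is `2(1 + κ)
  -- ≥ 3.4` times that of one, hence above `1.21`.
  have hc := cos_le_cos_of_emod h.pos (d := d) (j := 2) (by norm_num) (by omega) (by omega)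
  have hc2 : cos (π * (2 : ℤ) / ℓ) = 2 * cos (π / ℓ) ^ 2 - 1 := by
    rw [← cos_two_mul]; congr 1; push_cast; ring
  rw [hc2] at hc
  have hx := h.cross_section_gt
  have hk := h.cos_ge
  have hr := sq_nonneg ρ
  nlinarith [mul_nonneg hr (sub_nonneg.2 hc),
    mul_nonneg (by linarith : 0 ≤ ρ ^ 2 * (2 - 2 * cos (π / ℓ))) (sub_nonneg.2 hk)]

/-- The angular separation of atoms in adjacent cross-sections. -/
theorem dvd_of_odd (h : IsTubeData ℓ μ lam₁ lam₂ σ ρ) {d : ℤ} (hd : ¬ 2 ∣ d)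
    (hlt : ρ ^ 2 * (2 - 2 * cos (π * d / ℓ)) < 1.21) :
    2 * (ℓ : ℤ) ∣ d - 1 ∨ 2 * (ℓ : ℤ) ∣ d + 1 := by
  by_contra! hcon
  have hpos : (0 : ℤ) < 2 * ℓ := by have := h.pos; omega
  have h1 := Int.emod_nonneg d hpos.ne'
  have h2 := Int.emod_lt_of_pos d hpos
  have hdd := Int.emod_add_mul_ediv d (2 * ℓ)
  have h0 : d % (2 * ℓ) ≠ 1 := fun h0 => hcon.1 ⟨d / (2 * ℓ), by linarith⟩
  have h0' : d % (2 * ℓ) ≠ 2 * ℓ - 1 := fun h0 => hcon.2 ⟨d / (2 * ℓ) + 1, by linarith⟩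
  have h3 : d % (2 * ℓ) % 2 = d % 2 := Int.emod_emod_of_dvd d (Dvd.intro _ rfl)
  -- Otherwise the separation is at least three steps, and the squared chord of three steps is `(1 +
  -- 2κ)² ≥ 4` times that of one.
  have hc := cos_le_cos_of_emod h.pos (d := d) (j := 3) (by norm_num) (by omega) (by omega)
  have hc2 : cos (π * (3 : ℤ) / ℓ) = 4 * cos (π / ℓ) ^ 3 - 3 * cos (π / ℓ) := by
    rw [← cos_three_mul]; congr 1; push_cast; ring
  rw [hc2] at hc
  have hx := h.cross_section_gt
  have hk := h.cos_ge
  have hr := sq_nonneg ρ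
  have e : ρ ^ 2 * (2 - 2 * (4 * cos (π / ℓ) ^ 3 - 3 * cos (π / ℓ))) =
      ρ ^ 2 * (2 - 2 * cos (π / ℓ)) * (1 + 2 * cos (π / ℓ)) ^ 2 := by ring
  have e2 : 4 ≤ (1 + 2 * cos (π / ℓ)) ^ 2 := by nlinarith
  nlinarith [mul_nonneg hr (sub_nonneg.2 hc),
    mul_nonneg (by linarith : 0 ≤ ρ ^ 2 * (2 - 2 * cos (π / ℓ))) (sub_nonneg.2 e2)]

end IsTubeData

end Nanotube

end TubeGeometry

/-! ### Neighbours, bond lengths and bond angles in the infinite tube -/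

section TubeBonds

namespace Nanotube

namespace IsTubeData

variable {ℓ : ℕ} {μ lam₁ lam₂ σ ρ : ℝ}

/-- Atoms at distance less than `1.1` are equal or neighbours. -/
theorem eq_or_neighbor (h : IsTubeData ℓ μ lam₁ lam₂ σ ρ) {t e r t' e' r' : ℤ}
    (he : e = 0 ∨ e = 1) (he' : e' = 0 ∨ e' = 1) (hr : 2 ∣ r - t - e) (hr' : 2 ∣ r' - t' - e')
    (hlt : ‖atom ℓ μ σ ρ t' e' r' - atom ℓ μ σ ρ t e r‖ < 1.1) :
    (t' = t ∧ e' = e ∧ 2 * (ℓ : ℤ) ∣ r' - r) ∨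
      ∃ i, t' = (neighborIndex t e r i).1 ∧ e' = (neighborIndex t e r i).2.1 ∧
        2 * (ℓ : ℤ) ∣ r' - (neighborIndex t e r i).2.2 := by
  have hsq : ‖atom ℓ μ σ ρ t' e' r' - atom ℓ μ σ ρ t e r‖ ^ 2 < 1.21 := by
    have := norm_nonneg (atom ℓ μ σ ρ t' e' r' - atom ℓ μ σ ρ t e r)
    nlinarith
  rw [norm_sq_atom_sub] at hsq
  have hY : 0 ≤ ρ ^ 2 * (2 - 2 * cos (π * (r' - r : ℤ) / ℓ)) :=
    mul_nonneg (sq_nonneg _) (by linarith [cos_le_one (π * (r' - r : ℤ) / ℓ)])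
  have hX : |(t' - t : ℤ) * (μ / 2) + (e' - e : ℤ) * σ| < 1.1 := by
    apply abs_lt_of_sq_lt_sq _ (by norm_num)
    rw [show (1.1 : ℝ) ^ 2 = 1.21 by norm_num]
    linarith
  have hY' : ρ ^ 2 * (2 - 2 * cos (π * (r' - r : ℤ) / ℓ)) < 1.21 := by
    nlinarith [sq_nonneg ((t' - t : ℤ) * (μ / 2) + (e' - e : ℤ) * σ)]
  obtain ⟨n, hn⟩ : ∃ n, n = t' - t := ⟨_, rfl⟩
  rw [← hn] at hX
  obtain ⟨hX1, hX2⟩ := abs_lt.1 hX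
  have hσ := h.sigma_mem
  have hμ := h.period_mem
  -- The axial distance decides `t' - t`: equal sides `e` force `0`, since `μ/2 > 1.3`; different
  -- sides leave `0` and one neighbouring value. Parity then makes `r' - r` odd for the slanted
  -- bonds and even otherwise, and the angular separation does the rest.
  rcases he with rfl | rfl <;> rcases he' with rfl | rfl
  · have n0 : n = 0 := by
      by_contra h0
      rcases Int.lt_or_gt_of_ne h0 with h0 | h0
      · have : (n : ℝ) ≤ -1 := by exact_mod_cast (by omega : n ≤ -1)
        norm_num at hX1 hX2; nlinarith [hμ.1]
      · have : (1 : ℝ) ≤ n := by exact_mod_cast h0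
        norm_num at hX1 hX2; nlinarith [hμ.1]
    exact Or.inl ⟨by omega, rfl, h.dvd_of_even (by omega) hY'⟩
  · have n0 : n = 0 ∨ n = -1 := by
      by_contra! h0
      rcases Int.lt_or_gt_of_ne h0.1 with h1 | h1
      · have : (n : ℝ) ≤ -2 := by exact_mod_cast (by omega : n ≤ -2)
        norm_num at hX1 hX2; nlinarith [hμ.1, hσ.2]
      · have : (1 : ℝ) ≤ n := by exact_mod_cast h1
        norm_num at hX1 hX2; nlinarith [hμ.1, hσ.1]
    rcases n0 with n0 | n0
    · rcases h.dvd_of_odd (d := r' - r) (by omega) hY' with hd | hd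
      · refine Or.inr ⟨1, ?_, rfl, ?_⟩
        · simp [neighborIndex]; omega
        · simpa [neighborIndex, sub_sub] using hd
      · refine Or.inr ⟨2, ?_, rfl, ?_⟩
        · simp [neighborIndex]; omega
        · simpa [neighborIndex, sub_sub, sub_add] using hd
    · refine Or.inr ⟨0, ?_, rfl, ?_⟩
      · simp [neighborIndex]; omega
      · exact h.dvd_of_even (d := r' - r) (by omega) hY'
  · have n0 : n = 0 ∨ n = 1 := by
      by_contra! h0
      rcases Int.lt_or_gt_of_ne h0.1 with h1 | h1
      · have : (n : ℝ) ≤ -1 := by exact_mod_cast (by omega : n ≤ -1)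
        norm_num at hX1 hX2; nlinarith [hμ.1, hσ.1]
      · have : (2 : ℝ) ≤ n := by exact_mod_cast (by omega : 2 ≤ n)
        norm_num at hX1 hX2; nlinarith [hμ.1, hσ.2]
    rcases n0 with n0 | n0
    · rcases h.dvd_of_odd (d := r' - r) (by omega) hY' with hd | hd
      · refine Or.inr ⟨1, ?_, rfl, ?_⟩
        · simp [neighborIndex]; omega
        · simpa [neighborIndex, sub_sub] using hd
      · refine Or.inr ⟨2, ?_, rfl, ?_⟩
        · simp [neighborIndex]; omega
        · simpa [neighborIndex, sub_sub, sub_add] using hd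
    · refine Or.inr ⟨0, ?_, rfl, ?_⟩
      · simp [neighborIndex]; omega
      · exact h.dvd_of_even (d := r' - r) (by omega) hY'
  · have n0 : n = 0 := by
      by_contra h0
      rcases Int.lt_or_gt_of_ne h0 with h0 | h0
      · have : (n : ℝ) ≤ -1 := by exact_mod_cast (by omega : n ≤ -1)
        norm_num at hX1 hX2; nlinarith [hμ.1]
      · have : (1 : ℝ) ≤ n := by exact_mod_cast h0
        norm_num at hX1 hX2; nlinarith [hμ.1]
    exact Or.inl ⟨by omega, rfl, h.dvd_of_even (by omega) hY'⟩

end IsTubeData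

/-- The bond vectors of an atom. -/
noncomputable def bondVec (ℓ : ℕ) (μ σ ρ : ℝ) (t e r : ℤ) (i : Fin 3) : Space :=
  atom ℓ μ σ ρ (neighborIndex t e r i).1 (neighborIndex t e r i).2.1 (neighborIndex t e r i).2.2 -
    atom ℓ μ σ ρ t e r

namespace IsTubeData

variable {ℓ : ℕ} {μ lam₁ lam₂ σ ρ : ℝ}

theorem norm_bondVec (h : IsTubeData ℓ μ lam₁ lam₂ σ ρ) {t e r : ℤ} (he : e = 0 ∨ e = 1)
    (i : Fin 3) : ‖bondVec ℓ μ σ ρ t e r i‖ = ![lam₁, lam₂, lam₂] i := by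
  have h1 := h.lam₁_mem.1
  have h2 := h.lam₂_mem.1
  have hcos : cos (-π / ℓ) = cos (π / ℓ) := by rw [neg_div, cos_neg]
  have hsq : ‖bondVec ℓ μ σ ρ t e r i‖ ^ 2 = (![lam₁, lam₂, lam₂] i) ^ 2 := by
    have hs := h.sigma_eq
    have hr := h.radius_eq
    rw [bondVec, norm_sq_atom_sub]
    fin_cases i <;> rcases he with rfl | rfl <;> simp [neighborIndex, hcos] <;> rw [← sub_eq_zero]
    · rw [hs]; ring
    · rw [hs]; ring
    · linear_combination hr
    · linear_combination hr
    · linear_combination hr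
    · linear_combination hr
  rw [← abs_of_nonneg (norm_nonneg (bondVec ℓ μ σ ρ t e r i))]
  have h3 : 0 ≤ ![lam₁, lam₂, lam₂] i := by
    fin_cases i <;> simp <;> linarith
  rw [← abs_of_nonneg h3]
  exact (sq_eq_sq_iff_abs_eq_abs _ _).1 hsq

/-- The cosines of the bond angles. -/
theorem angle_bondVec (h : IsTubeData ℓ μ lam₁ lam₂ σ ρ) {t e r : ℤ} (he : e = 0 ∨ e = 1)
    {i j : Fin 3} (hij : i ≠ j) :
    InnerProductGeometry.angle (bondVec ℓ μ σ ρ t e r i) (bondVec ℓ μ σ ρ t e r j) =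
      arccos (if i = 0 ∨ j = 0 then -(σ / lam₂) else
        (σ / lam₂) ^ 2 - cos (π / ℓ) * (1 - (σ / lam₂) ^ 2)) := by
  have h1 : lam₁ ≠ 0 := by linarith [h.lam₁_mem.1]
  have h2 : lam₂ ≠ 0 := by linarith [h.lam₂_mem.1]
  have hs : μ / 2 = lam₁ + σ := by linarith [h.sigma_eq]
  have hr := h.radius_eq
  have hcos : cos (-π / ℓ) = cos (π / ℓ) := by rw [neg_div, cos_neg]
  have hcos2 : cos (π * 2 / ℓ) = 2 * cos (π / ℓ) ^ 2 - 1 := by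
    rw [← cos_two_mul]; congr 1; ring
  have hcos3 (x : ℝ) : cos (π * (x - 1 - (x + 1)) / ℓ) = 2 * cos (π / ℓ) ^ 2 - 1 := by
    rw [← cos_two_mul, ← cos_neg]; congr 1; ring
  -- By the law of cosines the angles are determined by squared distances between atoms, for which
  -- there is a closed formula.
  rw [InnerProductGeometry.angle,
    real_inner_eq_norm_mul_self_add_norm_mul_self_sub_norm_sub_mul_self_div_two]
  have hd : bondVec ℓ μ σ ρ t e r i - bondVec ℓ μ σ ρ t e r j =
      atom ℓ μ σ ρ (neighborIndex t e r i).1 (neighborIndex t e r i).2.1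
        (neighborIndex t e r i).2.2 -
      atom ℓ μ σ ρ (neighborIndex t e r j).1 (neighborIndex t e r j).2.1
        (neighborIndex t e r j).2.2 := by
    rw [bondVec, bondVec]; abel
  rw [hd, ← pow_two ‖_ - _‖, norm_sq_atom_sub, h.norm_bondVec he, h.norm_bondVec he]
  congr 1
  have hσ : σ = σ / lam₂ * lam₂ := by field_simp
  generalize σ / lam₂ = y at *
  fin_cases i <;> fin_cases j <;> rcases he with rfl | rfl <;>
    simp [neighborIndex, hcos, hcos2, hcos3] at hij ⊢ <;> rw [div_eq_iff (by positivity)]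
  -- These are the pairs with the axial bond; the remaining goals concern the two slanted bonds,
  -- whose ends are two angular steps apart.
  any_goals linear_combination -1 / 2 * hr - 1 / 2 * (μ / 2 + lam₁ + σ) * hs - lam₁ * hσ
  all_goals linear_combination -(1 + cos (π / ℓ)) * hr + (1 + cos (π / ℓ)) * (σ + y * lam₂) * hσ

end IsTubeData

end Nanotube

end TubeBonds

section TubeEnergy

namespace Nanotube

/-! ## The energy of zigzag nanotubes -/

/-- The substitution is `t = 2j + k + l`, `e = l`, `r = 2i + k`. Conversely `k` is the parity of `t
- e`, and `r` can be shifted by multiples of `2ℓ` so that `i` lies in `1, …, ℓ`. -/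
theorem tube_eq (ℓ : ℕ) (hℓ : 0 < ℓ) (μ lam₁ lam₂ : ℝ) :
    tube ℓ μ lam₁ lam₂ = {x | ∃ t e r : ℤ, (e = 0 ∨ e = 1) ∧ 2 ∣ r - t - e ∧
      x = atom ℓ μ (tubeSigma μ lam₁) (tubeRadius ℓ μ lam₁ lam₂) t e r} := by
  have hσ : tubeSigma μ lam₁ = μ / 2 - lam₁ := rfl
  ext x
  rw [tube, zigzag]
  constructor
  · rintro ⟨i, j, k, l, hi, hk, hl, rfl⟩
    refine ⟨2 * j + k + l, l, 2 * i + k, ?_, ?_, ?_⟩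
    · rcases hl with rfl | rfl <;> simp
    · omega
    · ext q
      fin_cases q
      · simp [atom, hσ]; ring
      · simp [atom]
      · simp [atom]
  · rintro ⟨t, e, r, he, hr, rfl⟩
    obtain ⟨k, hk, hkt⟩ : ∃ k : ℕ, (k = 0 ∨ k = 1) ∧ 2 ∣ t - k - e :=
      ⟨((t - e) % 2).toNat, by omega, by omega⟩
    obtain ⟨l, hl⟩ : ∃ l : ℕ, (l : ℤ) = e := ⟨e.toNat, by omega⟩
    obtain ⟨j, hj⟩ := hkt
    obtain ⟨q, hq⟩ : 2 ∣ r - k := by omega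
    have hpos : (0 : ℤ) < ℓ := by exact_mod_cast hℓ
    have h1 := Int.emod_nonneg (q - 1) hpos.ne'
    have h2 := Int.emod_lt_of_pos (q - 1) hpos
    have h3 := Int.emod_add_mul_ediv (q - 1) ℓ
    obtain ⟨i, hi⟩ : ∃ i : ℕ, (i : ℤ) = (q - 1) % ℓ + 1 := ⟨((q - 1) % ℓ + 1).toNat, by omega⟩
    refine ⟨i, j, k, l, ⟨by omega, by omega⟩, hk, by simp; omega, ?_⟩
    have hr' : r = (2 * i + k : ℤ) + 2 * ℓ * ((q - 1) / ℓ) := by linarith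
    rw [hr', atom_add_multiple hℓ, show t = 2 * j + k + e by linarith, ← hl]
    ext z
    fin_cases z
    · simp [atom, hσ]; ring
    · simp [atom]
    · simp [atom]

theorem isTubeData_of_mem {ℓ : ℕ} (hℓ : 4 ≤ ℓ) {μ : ℝ} (hμ : μ ∈ Ioo (2.6 : ℝ) 3.1) {p : ℝ × ℝ}
    (hp : p ∈ bondBox) :
    IsTubeData ℓ μ p.1 p.2 (tubeSigma μ p.1) (tubeRadius ℓ μ p.1 p.2) := by
  refine ⟨hℓ, hμ, hp.1, hp.2, rfl, ?_⟩
  have h4 : (4 : ℝ) ≤ ℓ := by exact_mod_cast hℓ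
  have hs : 0 < sin (π / (2 * ℓ)) := by
    apply sin_pos_of_pos_of_lt_pi (by positivity)
    rw [div_lt_iff₀ (by positivity)]
    nlinarith [pi_pos]
  have h1 : 0 ≤ p.2 ^ 2 - tubeSigma μ p.1 ^ 2 := by
    have h1 : tubeSigma μ p.1 < 0.65 := by unfold tubeSigma; linarith [hμ.2, hp.1.1]
    have h2 : 0 < tubeSigma μ p.1 := by unfold tubeSigma; linarith [hμ.1, hp.1.2]
    nlinarith [hp.2.1]
  have hc : cos (π / ℓ) = 1 - 2 * sin (π / (2 * ℓ)) ^ 2 := by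
    rw [sin_sq_eq_half_sub, show 2 * (π / (2 * ℓ)) = π / ℓ by field_simp]; ring
  rw [hc, tubeRadius, div_pow, sq_sqrt h1]
  field_simp
  ring

/-- The neighbours of an atom, with representatives in a cell of `m` minimal periods. -/
noncomputable def neighbor (ℓ m : ℕ) (μ σ ρ : ℝ) (t e r : ℤ) (i : Fin 3) : Space :=
  atom ℓ μ σ ρ ((neighborIndex t e r i).1 % (2 * m)) (neighborIndex t e r i).2.1
    (neighborIndex t e r i).2.2

theorem neighborIndex_parity {t e r : ℤ} (hr : 2 ∣ r - t - e) (i : Fin 3) :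
    2 ∣ (neighborIndex t e r i).2.2 - (neighborIndex t e r i).1 - (neighborIndex t e r i).2.1 := by
  fin_cases i <;> simp [neighborIndex] <;> omega

theorem neighborIndex_side {t e r : ℤ} (he : e = 0 ∨ e = 1) (i : Fin 3) :
    (neighborIndex t e r i).2.1 = 0 ∨ (neighborIndex t e r i).2.1 = 1 := by
  fin_cases i <;> simp [neighborIndex] <;> omega

namespace IsTubeData

variable {ℓ m : ℕ} {μ lam₁ lam₂ σ ρ : ℝ}

theorem period_le (h : IsTubeData ℓ μ lam₁ lam₂ σ ρ) (hm : 1 ≤ m) : 2.6 ≤ m * μ := by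
  have : (1 : ℝ) ≤ m := by exact_mod_cast hm
  nlinarith [h.period_mem.1]

theorem bondLength_mem (h : IsTubeData ℓ μ lam₁ lam₂ σ ρ) (i : Fin 3) :
    0.9 < ![lam₁, lam₂, lam₂] i ∧ ![lam₁, lam₂, lam₂] i < 1.1 := by
  have h1 := h.lam₁_mem
  have h2 := h.lam₂_mem
  fin_cases i
  · exact h1
  · exact h2
  · exact h2

/-- Reducing the axial index modulo `2m` translates the neighbour by `-1`, `0` or `1` periods, since
that index leaves the cell by at most one; so the short bond vector is among the three images
compared in `perVec`. -/
theorem perVec_neighbor (h : IsTubeData ℓ μ lam₁ lam₂ σ ρ) (hm : 1 ≤ m) {t e r : ℤ}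
    (ht : 0 ≤ t ∧ t < 2 * m) (he : e = 0 ∨ e = 1) (i : Fin 3) :
    perVec (m * μ) (neighbor ℓ m μ σ ρ t e r i) (atom ℓ μ σ ρ t e r) =
        bondVec ℓ μ σ ρ t e r i ∧
      perDist (m * μ) (neighbor ℓ m μ σ ρ t e r i) (atom ℓ μ σ ρ t e r) =
        ![lam₁, lam₂, lam₂] i := by
  rw [← h.norm_bondVec he i (r := r) (t := t)]
  refine perVec_eq (h.period_le hm) ?_ ?_
  · rw [h.norm_bondVec he i]
    exact (h.bondLength_mem i).2
  · have hlo : -1 ≤ (neighborIndex t e r i).1 := by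
      fin_cases i <;> simp [neighborIndex] <;> omega
    have hhi : (neighborIndex t e r i).1 ≤ 2 * m := by
      fin_cases i <;> simp [neighborIndex] <;> omega
    have hpos : (0 : ℤ) < 2 * m := by omega
    have hk1 : -1 ≤ (neighborIndex t e r i).1 / (2 * m) := by
      apply Int.le_ediv_of_mul_le hpos; omega
    have hk2 : (neighborIndex t e r i).1 / (2 * m) < 2 := by
      apply Int.ediv_lt_of_lt_mul hpos; omega
    have hdiv := Int.emod_add_mul_ediv (neighborIndex t e r i).1 (2 * m)
    have hv : bondVec ℓ μ σ ρ t e r i = neighbor ℓ m μ σ ρ t e r i +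
        (((neighborIndex t e r i).1 / (2 * m) : ℤ) : ℝ) • ((m * μ) • e₁) -
          atom ℓ μ σ ρ t e r := by
      rw [neighbor, ← atom_add_period, bondVec, hdiv]
    rw [hv]
    generalize (neighborIndex t e r i).1 / (2 * m) = k at *
    obtain rfl | rfl | rfl : k = 0 ∨ k = 1 ∨ k = -1 := by omega
    · left; simp
    · right; left; simp; abel
    · right; right; simp; abel

/-- The atoms of the cell. -/
theorem mem_cell_iff (h : IsTubeData ℓ μ lam₁ lam₂ σ ρ)
    {F : Set Space} (hF : F = {x | ∃ t e r : ℤ, (e = 0 ∨ e = 1) ∧ 2 ∣ r - t - e ∧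
      x = atom ℓ μ σ ρ t e r}) (x : Space) :
    x ∈ cell F (m * μ) ↔ ∃ t e r : ℤ, (0 ≤ t ∧ t < 2 * m) ∧ (e = 0 ∨ e = 1) ∧ 2 ∣ r - t - e ∧
      x = atom ℓ μ σ ρ t e r := by
  have hσ := h.sigma_mem
  have hμ := h.period_mem
  -- As `0 ≤ e σ < μ/2`, membership in the cell depends only on `t`.
  have hcoord (t e r : ℤ) : atom ℓ μ σ ρ t e r 0 = t * (μ / 2) + e * σ := by simp [atom]
  rw [cell, hF]
  constructor
  · rintro ⟨⟨t, e, r, he, hr, rfl⟩, h0, h1⟩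
    rw [hcoord] at h0 h1
    have he0 : (0 : ℝ) ≤ e * σ ∧ e * σ ≤ σ := by
      rcases he with rfl | rfl <;> simp <;> linarith [hσ.1]
    refine ⟨t, e, r, ⟨?_, ?_⟩, he, hr, rfl⟩
    · by_contra hcon
      have : (t : ℝ) ≤ -1 := by exact_mod_cast (by omega : t ≤ -1)
      nlinarith [hμ.1, hσ.2]
    · by_contra hcon
      have : (2 * m : ℝ) ≤ t := by exact_mod_cast (by omega : 2 * (m : ℤ) ≤ t)
      nlinarith [hμ.1]
  · rintro ⟨t, e, r, ⟨h0, h1⟩, he, hr, rfl⟩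
    have he0 : (0 : ℝ) ≤ e * σ ∧ e * σ ≤ σ := by
      rcases he with rfl | rfl <;> simp <;> linarith [hσ.1]
    refine ⟨⟨t, e, r, he, hr, rfl⟩, ?_, ?_⟩
    · rw [hcoord]
      have : (0 : ℝ) ≤ t := by exact_mod_cast h0
      nlinarith [hμ.1]
    · rw [hcoord]
      have : (t : ℝ) ≤ 2 * m - 1 := by exact_mod_cast (by omega : t ≤ 2 * (m : ℤ) - 1)
      nlinarith [hμ.1, hσ.2]

/-- The bonds of an atom of the cell. -/
theorem mem_bonds_iff (h : IsTubeData ℓ μ lam₁ lam₂ σ ρ) (hm : 1 ≤ m)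
    {F : Set Space} (hF : F = {x | ∃ t e r : ℤ, (e = 0 ∨ e = 1) ∧ 2 ∣ r - t - e ∧
      x = atom ℓ μ σ ρ t e r}) {t e r : ℤ} (ht : 0 ≤ t ∧ t < 2 * m) (he : e = 0 ∨ e = 1)
    (hr : 2 ∣ r - t - e) (x : Space) :
    (x, atom ℓ μ σ ρ t e r) ∈ bonds (cell F (m * μ)) (m * μ) ↔
      ∃ i, x = neighbor ℓ m μ σ ρ t e r i := by
  constructor
  · rintro ⟨hx, -, hne, hd⟩
    obtain ⟨t', e', r', ht', he', hr', rfl⟩ := (h.mem_cell_iff hF x).1 hx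
    obtain ⟨k, hk, hlt⟩ : ∃ k : ℤ, (k = 0 ∨ k = 1 ∨ k = -1) ∧
        ‖atom ℓ μ σ ρ (t' + 2 * m * k) e' r' - atom ℓ μ σ ρ t e r‖ < 1.1 := by
      rcases perDist_lt_iff.1 hd with h1 | h1 | h1
      · exact ⟨0, by simp, by rw [atom_add_period]; simpa using h1⟩
      · refine ⟨1, by simp, ?_⟩
        rw [atom_add_period]
        convert h1 using 2
        simp; abel
      · refine ⟨-1, by simp, ?_⟩
        rw [atom_add_period]
        convert h1 using 2
        simp; abel
    rcases h.eq_or_neighbor he he' hr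
      (by rcases hk with rfl | rfl | rfl <;> omega) hlt with ⟨h1, h2, h3⟩ | ⟨i, h1, h2, h3⟩
    · refine absurd ?_ hne
      -- Both indices lie in `[0, 2m)`, so `k = 0`: no atom is bonded to its own image, even for `m
      -- = 1`.
      have : t' = t := by rcases hk with rfl | rfl | rfl <;> omega
      rw [this, h2]
      exact atom_congr h.pos _ _ _ _ _ h3
    · refine ⟨i, ?_⟩
      rw [neighbor, ← h1, Int.add_mul_emod_self_left, Int.emod_eq_of_lt ht'.1 ht'.2, ← h2]
      exact atom_congr h.pos _ _ _ _ _ h3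
  · rintro ⟨i, rfl⟩
    have hpd := (h.perVec_neighbor hm ht he i (r := r)).2
    have hlen := h.bondLength_mem i
    have hpos : (0 : ℤ) < 2 * m := by omega
    refine ⟨(h.mem_cell_iff hF _).2 ⟨_, _, _, ⟨Int.emod_nonneg _ hpos.ne', Int.emod_lt_of_pos _ hpos⟩,
      neighborIndex_side he i, ?_, rfl⟩, (h.mem_cell_iff hF _).2 ⟨t, e, r, ht, he, hr, rfl⟩, ?_, ?_⟩
    · have h1 := neighborIndex_parity hr i
      have h2 : (neighborIndex t e r i).1 % (2 * m) % 2 = (neighborIndex t e r i).1 % 2 :=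
        Int.emod_emod_of_dvd _ (Dvd.intro _ rfl)
      omega
    · intro heq
      simp only at heq
      rw [heq] at hpd
      have : perDist (m * μ) (atom ℓ μ σ ρ t e r) (atom ℓ μ σ ρ t e r) ≤ 0 := by
        rw [perDist]; exact (min_le_left _ _).trans (by simp)
      linarith
    · simp only [hpd]; exact hlen.2

theorem slope_mem (h : IsTubeData ℓ μ lam₁ lam₂ σ ρ) : σ / lam₂ ∈ Ioo (0 : ℝ) 1 := by
  have h1 := h.sigma_mem
  have h2 := h.lam₂_mem
  have h3 : 0 < lam₂ := by linarith [h2.1]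
  exact ⟨div_pos (by linarith [h1.1]) h3, (div_lt_one h3).2 (by linarith [h1.2, h2.1])⟩

theorem cos_mem (h : IsTubeData ℓ μ lam₁ lam₂ σ ρ) : cos (π / ℓ) ∈ Ioo (0 : ℝ) 1 := by
  refine ⟨by linarith [h.cos_ge], lt_of_le_of_ne (cos_le_one _) fun hc => ?_⟩
  have := h.cross_section_gt
  rw [hc] at this
  norm_num at this

/-- Coinciding neighbours would have equal bond vectors and hence angle `0`, but all cosines of bond
angles are below `1`. The point is that the reduction modulo the period merges no neighbours, even
for `m = 1`. -/
theorem neighbor_injective (h : IsTubeData ℓ μ lam₁ lam₂ σ ρ) (hm : 1 ≤ m) {t e r : ℤ}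
    (ht : 0 ≤ t ∧ t < 2 * m) (he : e = 0 ∨ e = 1) :
    Function.Injective (neighbor ℓ m μ σ ρ t e r) := by
  intro i j hij
  by_contra hne
  have h1 := (h.perVec_neighbor hm ht he i (r := r)).1
  rw [hij, (h.perVec_neighbor hm ht he j (r := r)).1] at h1
  have h2 := h.angle_bondVec he hne (t := t) (r := r)
  have h0 : bondVec ℓ μ σ ρ t e r i ≠ 0 := by
    rw [← norm_pos_iff, h.norm_bondVec he]
    linarith [(h.bondLength_mem i).1]
  rw [h1, InnerProductGeometry.angle_self h0] at h2
  have h3 := arccos_eq_zero.1 h2.symm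
  have hs := h.slope_mem
  split_ifs at h3
  · linarith [hs.1]
  · linarith [(third_cos_mem h.cos_mem hs).2]

/-- All atoms have the same environment, so the energy is the number `2m · 2 · ℓ` of atoms times one
contribution. Half of the ordered bonds and angles at an atom gives the weights `1/2, 1` of the
lengths and `2, 1` of the angles. -/
theorem configEnergy_cell (h : IsTubeData ℓ μ lam₁ lam₂ σ ρ) (hm : 1 ≤ m)
    {F : Set Space} (hF : F = {x | ∃ t e r : ℤ, (e = 0 ∨ e = 1) ∧ 2 ∣ r - t - e ∧
      x = atom ℓ μ σ ρ t e r}) (v₂ v₃ : ℝ → ℝ) :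
    configEnergy v₂ v₃ (cell F (m * μ)) (m * μ) = 4 * m * ℓ *
      (1 / 2 * v₂ lam₁ + v₂ lam₂ + angleEnergy v₃ (cos (π / ℓ)) (σ / lam₂)) := by
  have hside (e : ℤ) : e ∈ Finset.Ico (0 : ℤ) 2 ↔ e = 0 ∨ e = 1 := by
    rw [Finset.mem_Ico]; omega
  have hlpos : (0 : ℤ) < ℓ := by exact_mod_cast h.pos
  let I : Finset (ℤ × ℤ × ℤ) := Finset.Ico 0 (2 * (m : ℤ)) ×ˢ Finset.Ico 0 2 ×ˢ Finset.Ico 0 (ℓ : ℤ)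
  have hI (a : ℤ × ℤ × ℤ) : a ∈ I ↔
      (0 ≤ a.1 ∧ a.1 < 2 * m) ∧ (a.2.1 = 0 ∨ a.2.1 = 1) ∧ 0 ≤ a.2.2 ∧ a.2.2 < ℓ := by
    rw [Finset.mem_product, Finset.mem_product, hside, Finset.mem_Ico, Finset.mem_Ico]
  -- Setting `r = 2q + t + e` builds in the parity condition, and `0 ≤ q < ℓ` runs once through the
  -- admissible residues of `r` modulo `2ℓ`.
  let P : ℤ × ℤ × ℤ → Space := fun a => atom ℓ μ σ ρ a.1 a.2.1 (2 * a.2.2 + a.1 + a.2.1)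
  have hpar (a : ℤ × ℤ × ℤ) : 2 ∣ 2 * a.2.2 + a.1 + a.2.1 - a.1 - a.2.1 := by omega
  have hcard : (I.card : ℝ) = 4 * m * ℓ := by
    have : I.card = 2 * m * (2 * ℓ) := by
      simp only [I, Finset.card_product, Int.card_Ico]
      congr 1
    rw [this]; push_cast; ring
  have hPinj : InjOn P I := by
    rintro ⟨t, e, i⟩ ha ⟨t', e', i'⟩ hb hab
    obtain ⟨ht, he, hi⟩ := (hI _).1 ha
    obtain ⟨ht', he', hi'⟩ := (hI _).1 hb
    simp only [P] at hab ht he hi ht' he' hi'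
    rcases h.eq_or_neighbor he he' (hpar (t, e, i)) (hpar (t', e', i'))
      (by rw [hab, sub_self, norm_zero]; norm_num) with ⟨rfl, rfl, h3⟩ | ⟨j, h1, h2, h3⟩
    · obtain ⟨k, hk⟩ := h3
      have hk' : i' - i = ℓ * k := by linarith
      have : k = 0 := by
        by_contra hk0
        rcases Int.lt_or_gt_of_ne hk0 with h0 | h0
        · nlinarith
        · nlinarith
      rw [this] at hk'
      simp only [Prod.mk.injEq, true_and]
      omega
    · exfalso
      have hc := atom_congr h.pos μ σ ρ t' e' h3
      have hn := h.norm_bondVec he j (t := t) (r := 2 * i + t + e)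
      rw [bondVec, ← h1, ← h2, ← hc, ← hab, sub_self, norm_zero] at hn
      linarith [(h.bondLength_mem j).1]
  have hC : cell F (m * μ) = P '' I := by
    ext x
    rw [h.mem_cell_iff hF]
    constructor
    · rintro ⟨t, e, r, ht, he, hr, rfl⟩
      obtain ⟨q, hq⟩ := hr
      refine ⟨(t, e, q % ℓ), (hI _).2 ⟨ht, he, Int.emod_nonneg _ hlpos.ne',
        Int.emod_lt_of_pos _ hlpos⟩, ?_⟩
      have hdiv := Int.emod_add_mul_ediv q ℓ
      exact atom_congr h.pos _ _ _ _ _ ⟨-(q / ℓ), by linarith⟩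
    · rintro ⟨a, ha, rfl⟩
      obtain ⟨ht, he, -⟩ := (hI _).1 ha
      exact ⟨a.1, a.2.1, _, ht, he, hpar a, rfl⟩
  rw [configEnergy_eq_of_threefold (I := I) (P := P) hPinj hC
    (nb := fun a => neighbor ℓ m μ σ ρ a.1 a.2.1 (2 * a.2.2 + a.1 + a.2.1))
    (d := ![lam₁, lam₂, lam₂])
    (w := fun i j => cosPotential v₃ (if i = 0 ∨ j = 0 then -(σ / lam₂) else
        (σ / lam₂) ^ 2 - cos (π / ℓ) * (1 - (σ / lam₂) ^ 2)))
    (fun a ha => h.neighbor_injective hm ((hI a).1 ha).1 ((hI a).1 ha).2.1)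
    (fun a ha x => h.mem_bonds_iff hm hF ((hI a).1 ha).1 ((hI a).1 ha).2.1 (hpar a) x)
    (fun a ha i => (h.perVec_neighbor hm ((hI a).1 ha).1 ((hI a).1 ha).2.1 i).2)
    (fun a ha i j hij => by
      rw [bondAngle, (h.perVec_neighbor hm ((hI a).1 ha).1 ((hI a).1 ha).2.1 i).1,
        (h.perVec_neighbor hm ((hI a).1 ha).1 ((hI a).1 ha).2.1 j).1,
        h.angle_bondVec ((hI a).1 ha).2.1 hij, cosPotential]), hcard]
  have hoff : (Finset.univ : Finset (Fin 3)).offDiag =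
      {(0, 1), (0, 2), (1, 0), (1, 2), (2, 0), (2, 1)} := by decide
  rw [hoff, Fin.sum_univ_three]
  simp [angleEnergy]
  ring

end IsTubeData

/-- The energy of a zigzag nanotube with `4 m ℓ` atoms. -/
theorem tubeEnergy_eq (v₂ v₃ : ℝ → ℝ) {ℓ m : ℕ} (hℓ : 4 ≤ ℓ) (hm : 1 ≤ m) {μ : ℝ}
    (hμ : μ ∈ Ioo (2.6 : ℝ) 3.1) {p : ℝ × ℝ} (hp : p ∈ bondBox) :
    tubeEnergy v₂ v₃ ℓ m μ p.1 p.2 =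
      4 * m * ℓ * energyDensity v₂ (angleEnergy v₃ (cos (π / ℓ))) μ p :=
  (isTubeData_of_mem hℓ hμ hp).configEnergy_cell hm (tube_eq ℓ (by omega) μ p.1 p.2) v₂ v₃

/-- All pairs of bond lengths in the box are admissible. -/
theorem admissible_eq {ℓ : ℕ} (hℓ : 4 ≤ ℓ) {μ : ℝ} (hμ : μ ∈ Ioo (2.6 : ℝ) 3.1) :
    admissible ℓ μ = bondBox := by
  ext p
  refine ⟨fun h => ⟨h.2.1, h.2.2⟩, fun hp => ⟨?_, hp.1, hp.2⟩⟩
  have hd := isTubeData_of_mem hℓ hμ hp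
  have h4 : (4 : ℝ) ≤ ℓ := by exact_mod_cast hℓ
  have hs : 0 < sin (π / (2 * ℓ)) := by
    apply sin_pos_of_pos_of_lt_pi (by positivity)
    rw [div_lt_iff₀ (by positivity)]
    nlinarith [pi_pos]
  have hσ := hd.sigma_mem
  have hσ0 : 0 < tubeSigma μ p.1 := by linarith [hσ.1]
  have hpos : 0 < p.2 ^ 2 - tubeSigma μ p.1 ^ 2 := by nlinarith [hp.2.1, hσ.1, hσ.2]
  have hlt : √(p.2 ^ 2 - tubeSigma μ p.1 ^ 2) < μ / 2 := by
    rw [sqrt_lt' (by linarith [hμ.1])]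
    nlinarith [hp.2.1, hp.2.2, hμ.1, sq_nonneg (tubeSigma μ p.1)]
  refine ⟨⟨by linarith [hp.1.1], by linarith [hp.1.2, hμ.1]⟩,
    ⟨by linarith [hp.2.1], by linarith [hp.2.2, hμ.1]⟩,
    ⟨hσ0, by linarith [hσ.2, hμ.1]⟩, ⟨?_, ?_⟩, ?_, ?_⟩
  · exact div_pos (sqrt_pos.2 hpos) (by positivity)
  · rw [tubeRadius, div_lt_div_iff₀ (by positivity) (by positivity)]
    nlinarith
  · unfold tubeSigma; ring
  · have hr := hd.radius_eq
    have hc : cos (π / ℓ) = 1 - 2 * sin (π / (2 * ℓ)) ^ 2 := by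
      rw [sin_sq_eq_half_sub, show 2 * (π / (2 * ℓ)) = π / ℓ by field_simp]; ring
    rw [hc] at hr
    linarith

end Nanotube

end TubeEnergy

section Assembly

open Filter Topology

namespace Nanotube

/-! ## Angles, radii and energies of optimal tubes -/

theorem sin_half_sq (ℓ : ℕ) (hℓ : 0 < ℓ) : sin (gam ℓ / 2) ^ 2 = (1 + cos (π / ℓ)) / 2 := by
  have h : (ℓ : ℝ) ≠ 0 := by positivity
  rw [gam, show π * (1 - 1 / (ℓ : ℝ)) / 2 = π / 2 - π / ℓ / 2 by field_simp, sin_pi_div_two_sub,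
    cos_sq]
  rw [show 2 * (π / ℓ / 2) = π / (ℓ : ℝ) by ring]
  ring

theorem cos_beta (ℓ : ℕ) (hℓ : 0 < ℓ) (α : ℝ) :
    cos (beta α (gam ℓ)) = cos α ^ 2 - cos (π / ℓ) * (1 - cos α ^ 2) := by
  have h := sin_half_sq ℓ hℓ
  have h1 : |sin α * sin (gam ℓ / 2)| ≤ 1 := by
    rw [abs_mul]
    exact mul_le_one₀ (abs_sin_le_one _) (abs_nonneg _) (abs_sin_le_one _)
  rw [beta, cos_two_mul, cos_sq', sin_arcsin (abs_le.1 h1).1 (abs_le.1 h1).2, mul_pow, h, sin_sq]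
  ring

theorem beta_mem (ℓ : ℕ) (hℓ : 0 < ℓ) {α : ℝ} (hα : α ∈ Icc 0 π) :
    beta α (gam ℓ) ∈ Icc 0 π := by
  have h1 : 0 ≤ sin (gam ℓ / 2) := by
    have hl : (1 : ℝ) ≤ ℓ := by exact_mod_cast hℓ
    have h2 : 1 / (ℓ : ℝ) ≤ 1 := by rw [div_le_one (by linarith)]; exact hl
    have h3 : 0 ≤ 1 / (ℓ : ℝ) := by positivity
    apply sin_nonneg_of_nonneg_of_le_pi
    · unfold gam
      nlinarith [pi_pos]
    · unfold gam
      nlinarith [pi_pos]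
  have h2 := arcsin_nonneg.2 (mul_nonneg (sin_nonneg_of_mem_Icc hα) h1)
  have h3 := arcsin_le_pi_div_two (sin α * sin (gam ℓ / 2))
  exact ⟨by unfold beta; linarith, by unfold beta; linarith⟩

/-- In terms of the cosine the equation is quadratic, with the roots `1` and `-κ/(1+κ)`; the first
lies outside the interval, and `κ > 0.7` puts the second inside. -/
theorem isPolyhedralAngle_arccos {ℓ : ℕ} (hℓ : 0 < ℓ) (hκ : cos (π / ℓ) ∈ Ioo (0.7 : ℝ) 1) :
    IsPolyhedralAngle ℓ (arccos (-(cos (π / ℓ) / (1 + cos (π / ℓ))))) := by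
  have hb := cos_beta ℓ hℓ
  generalize hk : cos (π / ℓ) = κ at *
  have h1 : 0 < 1 + κ := by linarith [hκ.1]
  have h2 : 0.41 < κ / (1 + κ) := by rw [lt_div_iff₀ h1]; linarith [hκ.1]
  have h3 : κ / (1 + κ) < 0.5 := by rw [div_lt_iff₀ h1]; linarith [hκ.2]
  have hmem : -(κ / (1 + κ)) ∈ Icc (-1 : ℝ) 1 := ⟨by linarith, by linarith⟩
  refine ⟨⟨strictAntiOn_arccos hmem ⟨by norm_num, by norm_num⟩ (by linarith),
    strictAntiOn_arccos ⟨by norm_num, by norm_num⟩ hmem (by linarith)⟩, fun α hα => ?_⟩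
  have hαπ : α ∈ Icc 0 π := ⟨(arccos_nonneg _).trans hα.1.le, hα.2.le.trans (arccos_le_pi _)⟩
  have hcos : -0.6 < cos α := by
    have := strictAntiOn_cos hαπ ⟨arccos_nonneg _, arccos_le_pi _⟩ hα.2
    rwa [cos_arccos (by norm_num) (by norm_num)] at this
  have e1 : beta α (gam ℓ) = α ↔ cos (beta α (gam ℓ)) = cos α :=
    ⟨fun h => by rw [h], fun h => injOn_cos (beta_mem ℓ hℓ hαπ) hαπ h⟩
  have e2 : α = arccos (-(κ / (1 + κ))) ↔ cos α = -(κ / (1 + κ)) :=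
    ⟨fun h => by rw [h, cos_arccos hmem.1 hmem.2], fun h => by
      rw [← h, arccos_cos hαπ.1 hαπ.2]⟩
  have e3 : cos α ^ 2 - κ * (1 - cos α ^ 2) - cos α =
      (1 - cos α) * (1 + κ) * (-(κ / (1 + κ)) - cos α) := by field_simp; ring
  rw [e1, e2, hb]
  constructor
  · intro h
    rw [h, sub_self] at e3
    have hc1 : cos α < 1 := by
      have := strictAntiOn_cos ⟨arccos_nonneg _, arccos_le_pi _⟩ hαπ hα.1
      rw [cos_arccos (by norm_num) (by norm_num)] at this
      linarith
    rcases mul_eq_zero.1 e3.symm with h0 | h0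
    · rcases mul_eq_zero.1 h0 with h0 | h0 <;> linarith
    · linarith
  · intro h
    rw [← h, sub_self, mul_zero] at e3
    linarith

theorem refAngles_iff {α : ℝ} (hα : α ∈ refAngles) : -cos α ∈ Ioo (0.3 : ℝ) 0.55 := by
  obtain ⟨-, h1, h2⟩ := hα
  constructor <;> linarith

theorem unitTubeEnergy_eq {v₂ v₃ : ℝ → ℝ} (hv₂ : IsTwoBodyPotential v₂) {ℓ m : ℕ} (hℓ : 4 ≤ ℓ)
    (hm : 1 ≤ m) {α : ℝ} (hα : α ∈ refAngles) : unitTubeEnergy v₂ v₃ ℓ m α =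
      4 * m * ℓ * (-3 / 2 + angleEnergy v₃ (cos (π / ℓ)) (-cos α)) := by
  rw [unitTubeEnergy, tubeEnergy_eq v₂ v₃ hℓ hm hα.2 (p := (1, 1)) one_mem_bondBox, energyDensity,
    hv₂.one_eq, show (2 * (1 - cos α) / 2 - 1) / 1 = -cos α by ring]
  ring

/-- With unit bonds the bond energy is constant and the slope is `-cos α`, so that minimizing over
`α` is minimizing the angle energy. -/
theorem isUnstretchedAngle_arccos {v₂ v₃ : ℝ → ℝ} (hv₂ : IsTwoBodyPotential v₂) {ℓ : ℕ}
    (hℓ : 4 ≤ ℓ) {s₀ : ℝ} (hs₀ : s₀ ∈ Ioo (0.3 : ℝ) 0.55)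
    (hmin : ∀ s ∈ Icc (0.18 : ℝ) 0.73, s ≠ s₀ →
      angleEnergy v₃ (cos (π / ℓ)) s₀ < angleEnergy v₃ (cos (π / ℓ)) s) :
    IsUnstretchedAngle v₂ v₃ ℓ (arccos (-s₀)) := by
  have hc : cos (arccos (-s₀)) = -s₀ := cos_arccos (by linarith [hs₀.2]) (by linarith [hs₀.1])
  have hmem : arccos (-s₀) ∈ refAngles := by
    refine ⟨⟨?_, ?_⟩, ?_⟩
    · rw [← not_le, arccos_le_pi_div_two]; linarith [hs₀.1]
    · refine lt_of_le_of_ne (arccos_le_pi _) fun h => ?_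
      rw [arccos_eq_pi] at h
      linarith [hs₀.2]
    · rw [hc]; constructor <;> linarith [hs₀.1, hs₀.2]
  refine ⟨hmem, fun m hm α hα => ?_⟩
  have hn : (0 : ℝ) < 4 * m * ℓ := by
    have h1 : (1 : ℝ) ≤ m := by exact_mod_cast hm
    have h2 : (4 : ℝ) ≤ ℓ := by exact_mod_cast hℓ
    positivity
  have hlt : ∀ α' ∈ refAngles, α' ≠ arccos (-s₀) →
      unitTubeEnergy v₂ v₃ ℓ m (arccos (-s₀)) < unitTubeEnergy v₂ v₃ ℓ m α' := by
    intro α' hα' hne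
    rw [unitTubeEnergy_eq hv₂ hℓ hm hmem, unitTubeEnergy_eq hv₂ hℓ hm hα', hc, neg_neg]
    have h1 := refAngles_iff hα'
    have h2 := hmin (-cos α') ⟨by linarith [h1.1], by linarith [h1.2]⟩ fun h => hne (by
      rw [← h, neg_neg, arccos_cos (by linarith [hα'.1.1, pi_pos]) hα'.1.2.le])
    exact mul_lt_mul_of_pos_left (by linarith) hn
  constructor
  · intro h
    by_contra hne
    exact absurd (h hmem) (not_le.2 (hlt α hα hne))
  · rintro rfl α' hα'
    by_cases h : α' = arccos (-s₀)
    · exact (congrArg (unitTubeEnergy v₂ v₃ ℓ m) h.symm).le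
    · exact (hlt α' hα' h).le

theorem tubeAngle_eq {μ lam₁ lam₂ : ℝ} (h : 0 ≤ tubeSigma μ lam₁ / lam₂) :
    tubeAngle μ lam₁ lam₂ = arccos (-(tubeSigma μ lam₁ / lam₂)) := by
  rw [tubeAngle, arccos_neg, arccos_eq_arcsin h]

theorem tendsto_cos_pi_div :
    Tendsto (fun ℓ : ℕ => cos (π / ℓ)) atTop (𝓝[<] 1) := by
  refine tendsto_nhdsWithin_iff.2 ⟨?_, ?_⟩
  · have h := (continuous_cos.tendsto 0).comp (tendsto_const_div_atTop_nhds_zero_nat π)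
    rwa [cos_zero] at h
  · filter_upwards [eventually_ge_atTop 1] with ℓ hℓ
    have hl : (1 : ℝ) ≤ ℓ := by exact_mod_cast hℓ
    have h0 : 0 < π / ℓ := by positivity
    have h1 : π / ℓ ≤ π := div_le_self pi_pos.le hl
    have := strictAntiOn_cos (left_mem_Icc.2 pi_pos.le) ⟨h0.le, h1⟩ h0
    rwa [cos_zero] at this

/-- Optimality of a pair of bond lengths in terms of the energy per atom. -/
theorem isOptimal_iff (v₂ v₃ : ℝ → ℝ) {ℓ m : ℕ} (hℓ : 4 ≤ ℓ) (hm : 1 ≤ m) {μ : ℝ}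
    (hμ : μ ∈ Ioo (2.6 : ℝ) 3.1) (p : ℝ × ℝ) :
    IsOptimal v₂ v₃ ℓ m μ p ↔ p ∈ bondBox ∧ ∀ q ∈ bondBox,
      energyDensity v₂ (angleEnergy v₃ (cos (π / ℓ))) μ p ≤
        energyDensity v₂ (angleEnergy v₃ (cos (π / ℓ))) μ q := by
  have hn : (0 : ℝ) < 4 * m * ℓ := by
    have h1 : (1 : ℝ) ≤ m := by exact_mod_cast hm
    have h2 : (4 : ℝ) ≤ ℓ := by exact_mod_cast hℓ
    positivity
  rw [IsOptimal, admissible_eq hℓ hμ]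
  refine and_congr_right fun hp => forall₂_congr fun q hq => ?_
  rw [tubeEnergy_eq v₂ v₃ hℓ hm hμ hp, tubeEnergy_eq v₂ v₃ hℓ hm hμ hq, mul_le_mul_iff_right₀ hn]

theorem Emin_eq_of_isOptimal {v₂ v₃ : ℝ → ℝ} {ℓ m : ℕ} {μ : ℝ} {p : ℝ × ℝ}
    (h : IsOptimal v₂ v₃ ℓ m μ p) : Emin v₂ v₃ ℓ m μ = tubeEnergy v₂ v₃ ℓ m μ p.1 p.2 :=
  IsLeast.csInf_eq ⟨⟨p, h.1, rfl⟩, by rintro _ ⟨q, hq, rfl⟩; exact h.2 q hq⟩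

/-- The denominator of the radius depends on `ℓ` only, and the square root is strictly increasing
from a nonnegative radicand on. -/
theorem tubeRadius_lt_iff {ℓ : ℕ} (hℓ : 4 ≤ ℓ) {μ μ' lam₁ lam₁' lam₂ lam₂' : ℝ}
    (h : 0 ≤ lam₂ ^ 2 - (μ / 2 - lam₁) ^ 2) :
    tubeRadius ℓ μ lam₁ lam₂ < tubeRadius ℓ μ' lam₁' lam₂' ↔
      lam₂ ^ 2 - (μ / 2 - lam₁) ^ 2 < lam₂' ^ 2 - (μ' / 2 - lam₁') ^ 2 := by
  have h4 : (4 : ℝ) ≤ ℓ := by exact_mod_cast hℓ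
  have hs : 0 < sin (π / (2 * ℓ)) := by
    apply sin_pos_of_pos_of_lt_pi (by positivity)
    rw [div_lt_iff₀ (by positivity)]
    nlinarith [pi_pos]
  rw [tubeRadius, tubeRadius, div_lt_div_iff_of_pos_right (by positivity)]
  exact sqrt_lt_sqrt_iff h

end Nanotube

end Assembly

/-! ### The theorem, assembled from the angle energy and the stretched minimizers -/

theorem proposition3p4 (v₂ v₃ : ℝ → ℝ)
    (hv₂ : IsTwoBodyPotential v₂) (hv₃ : IsThreeBodyPotential v₃) :
    ∃ (ℓ₀ : ℕ) (c : ℝ), 0 < c ∧ ∀ ℓ : ℕ, ℓ₀ ≤ ℓ →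
      ∃ (αch αus : ℝ) (a b : ℝ) (lam₁ lam₂ : ℝ → ℝ),
        -- the Polyhedral angle, the unstretched angle and the associated minimal period
        IsPolyhedralAngle ℓ αch ∧
        IsUnstretchedAngle v₂ v₃ ℓ αus ∧
        αus ∈ Ioo αch (2 * π / 3) ∧
        2 - 2 * cos αus ∈ Ioo a b ∧
        Ioo a b ⊆ Ioo 2.6 3.1 ∧
        -- `(lam₁ μ, lam₂ μ)` is the unique minimizing pair of bond lengths
        (∀ m : ℕ, 1 ≤ m → ∀ μ ∈ Ioo a b, ∀ p : ℝ × ℝ,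
          IsOptimal v₂ v₃ ℓ m μ p ↔ p = (lam₁ μ, lam₂ μ)) ∧
        -- Property 1
        (∀ m : ℕ, 1 ≤ m →
          (∀ μ ∈ Ioo a b, tubeEnergy v₂ v₃ ℓ m μ (lam₁ μ) (lam₂ μ) = Emin v₂ v₃ ℓ m μ) ∧
          ContDiffOn ℝ ∞ (Emin v₂ v₃ ℓ m) (Ioo a b) ∧
          StrictConvexOn ℝ (Ioo a b) (Emin v₂ v₃ ℓ m) ∧
          IsMinOn (Emin v₂ v₃ ℓ m) (Ioo a b) (2 - 2 * cos αus) ∧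
          c * (4 * m * ℓ) ≤ iteratedDeriv 2 (Emin v₂ v₃ ℓ m) (2 - 2 * cos αus)) ∧
        -- Property 2
        (ContinuousOn lam₁ (Ioo a b) ∧ StrictMonoOn lam₁ (Ioo a b) ∧
          ContinuousOn lam₂ (Ioo a b) ∧ StrictMonoOn lam₂ (Ioo a b) ∧
          (∀ μ ∈ Ioo a b, 2 - 2 * cos αus < μ → 1 < lam₁ μ ∧ 1 < lam₂ μ) ∧
          (∀ μ ∈ Ioo a b, μ < 2 - 2 * cos αus → lam₁ μ < 1 ∧ lam₂ μ < 1)) ∧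
        -- Property 3
        (∀ μ ∈ Ioo a b, tubeAngle μ (lam₁ μ) (lam₂ μ) ∈ Ioo αch (2 * π / 3)) ∧
        -- Property 4
        (iteratedDeriv 2 v₂ 1 < 6 * iteratedDeriv 2 v₃ (2 * π / 3) →
          ContinuousOn (fun μ => tubeRadius ℓ μ (lam₁ μ) (lam₂ μ)) (Ioo a b) ∧
          StrictMonoOn (fun μ => tubeRadius ℓ μ (lam₁ μ) (lam₂ μ)) (Ioo a b)) ∧
        (6 * iteratedDeriv 2 v₃ (2 * π / 3) < iteratedDeriv 2 v₂ 1 →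
          ContinuousOn (fun μ => tubeRadius ℓ μ (lam₁ μ) (lam₂ μ)) (Ioo a b) ∧
          StrictAntiOn (fun μ => tubeRadius ℓ μ (lam₁ μ) (lam₂ μ)) (Ioo a b)) := by
  have hB := hv₃.second_deriv_pos
  have ha := hv₂.second_deriv_pos
  obtain ⟨ℓ₁, hℓ₁⟩ := Filter.eventually_atTop.1
    (tendsto_cos_pi_div.eventually (eventually_exists_unstretched hv₃ (iteratedDeriv 2 v₂ 1)))
  rw [iteratedDeriv_two_eq v₂] at *
  set B := iteratedDeriv 2 v₃ (2 * π / 3)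
  set A := deriv (deriv v₂) 1
  -- From `4B < G < 12B` and `s₀² ≤ 1` it follows that `D ≤ 1 + 3 · 12 B/A`, so that `G/(4D)` is at
  -- least this constant, uniformly in `ℓ`. The bound `6` gives `cos (π / ℓ) > 0.7` with room to
  -- spare.
  refine ⟨max ℓ₁ 6, B / (1 + 36 * (B / A)), by positivity, fun ℓ hℓ => ?_⟩
  obtain ⟨s₀, hs₀, hs₀', hmin, hG1, hG2, hG3, hG4⟩ := hℓ₁ ℓ (le_of_max_le_left hℓ)
  have h6 : 6 ≤ ℓ := le_of_max_le_right hℓ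
  have h4 : 4 ≤ ℓ := by omega
  have hκ : cos (π / ℓ) ∈ Ioo (0.7 : ℝ) 1 := by
    have h := isTubeData_of_mem h4 (μ := 3) ⟨by norm_num, by norm_num⟩ one_mem_bondBox
    refine ⟨?_, h.cos_mem.2⟩
    have h6' : (6 : ℝ) ≤ ℓ := by exact_mod_cast h6
    have h1 : cos (π / 6) ≤ cos (π / ℓ) := by
      refine cos_le_cos_of_nonneg_of_le_pi (by positivity) (by linarith [pi_pos]) ?_
      gcongr
    rw [cos_pi_div_six] at h1
    have : (1.7 : ℝ) ≤ √3 := le_sqrt_of_sq_le (by norm_num)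
    linarith
  have hκ' : cos (π / ℓ) ∈ Ioo (0 : ℝ) 1 := ⟨by linarith [hκ.1], hκ.2⟩
  have hch0 : 0 < cos (π / ℓ) / (1 + cos (π / ℓ)) := div_pos hκ'.1 (by linarith [hκ'.1])
  have hGpos : 0 < deriv (deriv (angleEnergy v₃ (cos (π / ℓ)))) s₀ := by linarith
  -- The neighbourhood `U` of `s₀` is the interval between the polyhedral and the rolled-up slope,
  -- which yields the bounds on the angle along the whole branch.
  obtain ⟨a, b, lam₁, lam₂, hab, hsub, hopt, hsmooth, hconv, hismin, hsecond, c1, m1, c2, m2,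
    o1, o2, hU, hinc, hdec⟩ := exists_stretched_minimizers hv₂
      (contDiffOn_angleEnergy hv₃ hκ') hs₀' hmin hGpos (Ioo_mem_nhds hs₀.1 hs₀.2)
  have hcos : cos (arccos (-s₀)) = -s₀ := cos_arccos (by linarith [hs₀'.2]) (by linarith [hs₀'.1])
  have hμ₀ : 2 - 2 * cos (arccos (-s₀)) = 2 * (1 + s₀) := by rw [hcos]; ring
  have hangle : ∀ s ∈ Ioo (cos (π / ℓ) / (1 + cos (π / ℓ))) (1 / 2),
      arccos (-s) ∈ Ioo (arccos (-(cos (π / ℓ) / (1 + cos (π / ℓ))))) (2 * π / 3) := by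
    intro s hs
    have k1 : -s ∈ Icc (-1 : ℝ) 1 := ⟨by linarith [hs.2], by linarith [hs.1]⟩
    refine ⟨strictAntiOn_arccos k1 ⟨by linarith [hs.1, hs.2], by linarith⟩
      (by linarith [hs.1]), ?_⟩
    rw [← arccos_neg_half]
    exact strictAntiOn_arccos ⟨by norm_num, by norm_num⟩ k1 (by linarith [hs.2])
  have hbox : ∀ μ ∈ Ioo a b, (lam₁ μ, lam₂ μ) ∈ bondBox := fun μ hμ => ((hopt μ hμ _).2 rfl).1
  have hEmin : ∀ m : ℕ, 1 ≤ m → ∀ μ ∈ Ioo a b, Emin v₂ v₃ ℓ m μ = 4 * m * ℓ *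
      energyDensity v₂ (angleEnergy v₃ (cos (π / ℓ))) μ (lam₁ μ, lam₂ μ) := by
    intro m hm μ hμ
    have h := (isOptimal_iff v₂ v₃ h4 hm (hsub hμ) _).2 ((hopt μ hμ _).2 rfl)
    rw [Emin_eq_of_isOptimal h, tubeEnergy_eq v₂ v₃ h4 hm (hsub hμ) (hbox μ hμ)]
  have hR : ∀ μ ∈ Ioo a b, 0 ≤ lam₂ μ ^ 2 - (μ / 2 - lam₁ μ) ^ 2 := by
    intro μ hμ
    have h := isTubeData_of_mem h4 (hsub hμ) (hbox μ hμ)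
    have h1 := h.sigma_mem
    have h2 := h.lam₂_mem
    simp only [tubeSigma] at h1 h2
    nlinarith [h1.1, h1.2, h2.1]
  have hRc : ContinuousOn (fun μ => tubeRadius ℓ μ (lam₁ μ) (lam₂ μ)) (Ioo a b) := by
    refine ContinuousOn.div_const (ContinuousOn.sqrt ((c2.pow 2).sub (ContinuousOn.pow ?_ 2))) _
    exact (continuousOn_id.div_const 2).sub c1
  refine ⟨arccos (-(cos (π / ℓ) / (1 + cos (π / ℓ)))), arccos (-s₀), a, b, lam₁, lam₂,
    isPolyhedralAngle_arccos (by omega) hκ, isUnstretchedAngle_arccos hv₂ h4 hs₀' hmin,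
    hangle s₀ hs₀, hμ₀ ▸ hab, hsub, ?_, ?_, ⟨c1, m1, c2, m2, ?_, ?_⟩, ?_, ?_, ?_⟩
  · intro m hm μ hμ p
    rw [isOptimal_iff v₂ v₃ h4 hm (hsub hμ)]
    exact hopt μ hμ p
  · intro m hm
    have hn : (0 : ℝ) < 4 * m * ℓ := by
      have h1 : (1 : ℝ) ≤ m := by exact_mod_cast hm
      have h2 : (4 : ℝ) ≤ ℓ := by exact_mod_cast h4
      positivity
    rw [hμ₀]
    refine ⟨fun μ hμ => ?_, ?_, ?_, ?_, ?_⟩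
    · rw [hEmin m hm μ hμ, tubeEnergy_eq v₂ v₃ h4 hm (hsub hμ) (hbox μ hμ)]
    · exact (contDiffOn_const.mul hsmooth).congr (hEmin m hm)
    · refine ⟨convex_Ioo a b, fun x hx y hy hxy p q hp hq hpq => ?_⟩
      have h1 := hconv.2 hx hy hxy hp hq hpq
      rw [hEmin m hm x hx, hEmin m hm y hy,
        hEmin m hm _ ((convex_Ioo a b) hx hy hp.le hq.le hpq)]
      simp only [smul_eq_mul] at h1 ⊢
      refine (mul_lt_mul_of_pos_left h1 hn).trans_eq ?_
      ring
    · intro μ hμ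
      have h1 := hismin hμ
      change Emin v₂ v₃ ℓ m _ ≤ Emin v₂ v₃ ℓ m μ
      rw [hEmin m hm μ hμ, hEmin m hm _ hab]
      exact mul_le_mul_of_nonneg_left h1 hn.le
    · have he : Emin v₂ v₃ ℓ m =ᶠ[nhds (2 * (1 + s₀))] fun μ => 4 * m * ℓ *
          energyDensity v₂ (angleEnergy v₃ (cos (π / ℓ))) μ (lam₁ μ, lam₂ μ) :=
        Filter.eventually_of_mem (Ioo_mem_nhds hab.1 hab.2) (hEmin m hm)
      have h2 : iteratedDeriv 2 (fun μ => 4 * m * ℓ *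
          energyDensity v₂ (angleEnergy v₃ (cos (π / ℓ))) μ (lam₁ μ, lam₂ μ)) (2 * (1 + s₀)) =
          4 * m * ℓ * iteratedDeriv 2 (fun μ =>
          energyDensity v₂ (angleEnergy v₃ (cos (π / ℓ))) μ (lam₁ μ, lam₂ μ))
            (2 * (1 + s₀)) := iteratedDeriv_const_mul_field _ _
      rw [he.iteratedDeriv_eq, h2, hsecond, mul_comm]
      refine mul_le_mul_of_nonneg_left ?_ hn.le
      set G := deriv (deriv (angleEnergy v₃ (cos (π / ℓ)))) s₀
      have hGA : 0 < G / A := by positivity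
      have hs2 : s₀ ^ 2 ≤ 1 := by nlinarith [hs₀'.1, hs₀'.2]
      have hGA2 : G / A ≤ 12 * (B / A) := by
        rw [← mul_div_assoc]
        exact div_le_div_of_nonneg_right hG2.le ha.le
      rw [div_le_div_iff₀ (by positivity) (by positivity)]
      have hD : 1 + (2 + s₀ ^ 2) * (G / A) ≤ 1 + 36 * (B / A) := by nlinarith
      nlinarith [mul_le_mul_of_nonneg_left hD hB.le,
        mul_pos (by linarith : 0 < G - 4 * B) (by positivity : 0 < 1 + 36 * (B / A))]
  · intro μ hμ hlt
    rw [hμ₀] at hlt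
    exact ⟨(m1 hab hμ hlt).trans_eq' o1, (m2 hab hμ hlt).trans_eq' o2⟩
  · intro μ hμ hlt
    rw [hμ₀] at hlt
    exact ⟨(m1 hμ hab hlt).trans_eq o1, (m2 hμ hab hlt).trans_eq o2⟩
  · intro μ hμ
    have h := hU μ hμ
    rw [tubeAngle_eq (by exact hch0.le.trans h.1.le)]
    exact hangle _ h
  · intro h
    refine ⟨hRc, fun μ hμ μ' hμ' hlt => ?_⟩
    exact (tubeRadius_lt_iff h4 (hR μ hμ)).2 (hinc (hG3 h) hμ hμ' hlt)
  · intro h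
    refine ⟨hRc, fun μ hμ μ' hμ' hlt => ?_⟩
    exact (tubeRadius_lt_iff h4 (hR μ' hμ')).2 (hdec (hG4 h) hμ hμ' hlt)
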